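/- **Conventions.** Let $dg$ be the normalised Haar measure of $SU(2)$, $h_\theta=\mathrm{diag}(e^{i\theta},e^{-i\theta})$ ($\theta\in\mathbb R$; the conjugacy classes are labelled by $\theta\in[0,\pi]$), and $\chi_j$ ($j\in\mathbb N$) the character of the irreducible representation of dimension $j+1$. Let $F(SU(2))$ be the algebra of continuous functions, and $D(SU(2))=\mathbb C[SU(2)]\otimes F(SU(2))$ the quantum double of $\mathbb C[SU(2)]$, with product $(x\otimes f)(y\otimes g)=xy\otimes (f\circ \mathrm{Ad}_y)\,g$, where $\mathrm{Ad}_y(a)=yay^{-1}$, unit $1\otimes 1$, antipode $S(x\otimes f)=x^{-1}\otimes\big(a\mapsto f(x^{-1}a^{-1}x)\big)$ and involution $(x\otimes f)^*=x^{-1}\otimes(\bar f\circ \mathrm{Ad}_{x^{-1}})$. Elements $p\otimes g$ of $D(SU(2))^*$ ($p\in F(SU(2))$, $g\in SU(2)$) are the linear forms $\langle p\otimes g,x\otimes f\rangle=p(x)f(g)$. A (unitary) representation is a unital $*$-homomorphism $\rho$ from $D(SU(2))$ to the bounded operators of a complex Hilbert space $V$. It is *simple* if it is irreducible; its restriction to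 $SU(2)$ is an orthogonal direct sum of (finite-dimensional, continuous) irreducible representations; the trivial one occurs with multiplicity one; and the space of $SU(2)$-invariant continuous linear forms on $V$ is one-dimensional and does not vanish on the invariant vectors. For a unit $SU(2)$-invariant vector $\omega$ and the $SU(2)$-invariant form $\phi$ with $\phi(\omega)=1$, the *symmetric kernel* is $K=\langle\phi|\rho(\cdot)|\omega\rangle\in D(SU(2))^*$, and the *symmetric propagator* is $(\mathrm{id}\otimes S)\Delta(K)$, i.e. the bilinear form $(X,Y)\mapsto K(X\,S(Y))$. For $h_\theta$ not central ($\sin\theta\neq0$, centralizer $U(1)=\{n=\mathrm{diag}(e^{i\xi},e^{-i\xi})\}$) and $s\in\mathbb Z$, the representation $(\theta,s)$ acts on $$\mathcal V_{\theta,s}=\{\psi\in L^2(SU(2)) : \psi(a\,n)=e^{is\xi}\psi(a)\ \ \forall\, n=\mathrm{diag}(e^{i\xi},e^{-i\xi})\}$$ by $[\rho(x\otimes f)\psi](a)=f(x^{-1}ah_\theta a^{-1}x)\,\psi(x^{-1}a)$. For $h_\theta$ central ($\sin\theta=0$, centralizer $SU(2)$) and an irreducible unitary representation $\pi$ of $SU(2)$,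 the representation $(\theta,\pi)$ is $x\otimes f\mapsto f(h_\theta)\pi(x)$. For every $\theta$, $(\theta,0)$ is the representation given by the above formula on the space $\mathcal V_{\theta,0}$ of the $\psi\in L^2(SU(2))$ that are right invariant under the centralizer of $h_\theta$. **Proposition.** 1. Every $(\theta,0)$ is simple. If $h_\theta$ is not central, $(\theta,s)$ is simple if and only if $s=0$; if $h_\theta$ is central, $(\theta,\pi)$ is simple if and only if $\pi$ is trivial. Every simple representation of $D(SU(2))$ is unitarily equivalent to $(\theta,0)$ for exactly one $\theta\in[0,\pi]$. 2. In $(\theta,0)$ the normalised $SU(2)$-invariant vector is, uniquely up to a phase, the constant function $\omega=1$, and the invariant form with $\phi(\omega)=1$ is $\phi=\langle\omega|\cdot\rangle$. 3. For every representation unitarily equivalent to $(\theta,0)$, with any such $\omega,\phi$, the symmetric kernel $K_\theta$ lies in $F(SU(2))^*\subset D(SU(2))^*$ and is $$K_\theta(x\otimes f)=\int f(gh_\theta g^{-1})\,dg\qquad(x\in SU(2),\ f\in F(SU(2))).$$ Moreover there is exactly one conjugation-invariant probability measure $\delta_\theta(g)\,dg$ carried by the conjugacy class of $h_\theta$, and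 $K_\theta=1\otimes\int \delta_\theta(g)\,g\,dg$. The kernel has the Fourier expansion $$K_\theta=1\otimes\sum_{j\in\mathbb N}\chi_j(h_\theta)\int \chi_j(g)\,g\,dg ,$$ in the sense of distributions: evaluated on any element of $\mathbb C[SU(2)]\otimes C^\infty(SU(2))\subset D(SU(2))$, the series converges absolutely to the value of $K_\theta$. 4. The symmetric propagator is $$K_\theta(x,y)=\int\delta_\theta(g)\,(1\otimes g)\otimes(1\otimes g^{-1})\,dg=\sum_{j\in\mathbb N}\chi_j(h_\theta)\int\chi_j(g)\,(1\otimes g)\otimes(1\otimes g^{-1})\,dg,$$ the first equality as bilinear forms on $D(SU(2))$, the second one, with absolute convergence, on all pairs of elements of $\mathbb C[SU(2)]\otimes C^\infty(SU(2))$. -/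

import Mathlib

open MeasureTheory

open scoped InnerProductSpace

noncomputable section

namespace SU2Double

/-! ### The compact group SU(2) and its normalised Haar measure -/

/-- The group `SU(2)`. -/
abbrev SU2 : Type := ↥(Matrix.specialUnitaryGroup (Fin 2) ℂ)

instance : ContinuousInv SU2 :=
  ⟨Continuous.subtype_mk (continuous_star.comp continuous_subtype_val) _⟩

instance : IsTopologicalGroup SU2 where

instance : CompactSpace SU2 := by
  have hB : IsCompact (Set.pi Set.univ (fun _ : Fin 2 => Set.pi Set.univ
      (fun _ : Fin 2 => Metric.closedBall (0 : ℂ) 1))) :=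
    isCompact_univ_pi fun _ => isCompact_univ_pi fun _ => isCompact_closedBall _ _
  have hC : IsClosed ((Matrix.specialUnitaryGroup (Fin 2) ℂ : Submonoid _) :
      Set (Matrix (Fin 2) (Fin 2) ℂ)) := by
    have : ((Matrix.specialUnitaryGroup (Fin 2) ℂ : Submonoid _) :
        Set (Matrix (Fin 2) (Fin 2) ℂ)) = {A | A * star A = 1} ∩ {A | A.det = 1} := by
      ext A
      simp only [SetLike.mem_coe, Matrix.mem_specialUnitaryGroup_iff,
        Matrix.mem_unitaryGroup_iff, Set.mem_inter_iff, Set.mem_ofPred_eq]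
    rw [this]
    exact (isClosed_eq (continuous_id.mul continuous_star) continuous_const).inter
      (isClosed_eq (continuous_id.matrix_det) continuous_const)
  refine isCompact_iff_compactSpace.mp (IsCompact.of_isClosed_subset hB hC ?_)
  intro A hA i _ j _
  simpa using entry_norm_bound_of_unitary
    (Matrix.specialUnitaryGroup_le_unitaryGroup hA) i j

instance : SecondCountableTopology SU2 := by
  have : SecondCountableTopology (Matrix (Fin 2) (Fin 2) ℂ) :=
    inferInstanceAs (SecondCountableTopology (Fin 2 → Fin 2 → ℂ))
  exact TopologicalSpace.Subtype.secondCountableTopology _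

instance : MeasurableSpace SU2 := borel SU2

instance : BorelSpace SU2 := ⟨rfl⟩

/-- The normalised Haar measure `dg` of `SU(2)`. -/
def haar : Measure SU2 := Measure.haarMeasure (⊤ : TopologicalSpace.PositiveCompacts SU2)

instance : haar.IsHaarMeasure := by unfold haar; infer_instance

instance : IsProbabilityMeasure haar :=
  ⟨by simpa [haar] using Measure.haarMeasure_self (K₀ := (⊤ : TopologicalSpace.PositiveCompacts SU2))⟩

instance : haar.IsMulRightInvariant where
  map_mul_right_eq_self g := by
    have : IsProbabilityMeasure (haar.map (· * g)) :=
      Measure.isProbabilityMeasure_map (by fun_prop)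
    exact Measure.isHaarMeasure_eq_of_isProbabilityMeasure _ _

/-- The representative `h_θ = diag(e^{iθ}, e^{-iθ})` of a conjugacy class. -/
def hTheta (θ : ℝ) : SU2 :=
  ⟨!![Complex.exp (θ * Complex.I), 0; 0, Complex.exp (-(θ * Complex.I))], by
    rw [Matrix.mem_specialUnitaryGroup_iff, Matrix.mem_unitaryGroup_iff]
    have h1 : (starRingEnd ℂ) (Complex.exp (θ * Complex.I)) = Complex.exp (-(θ * Complex.I)) := by
      rw [← Complex.exp_conj]; simp
    have h2 : (starRingEnd ℂ) (Complex.exp (-(θ * Complex.I))) = Complex.exp (θ * Complex.I) := by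
      rw [← Complex.exp_conj]; simp
    constructor
    · ext i j
      fin_cases i <;> fin_cases j <;>
        simp [Matrix.mul_apply, Matrix.star_apply, h1, h2, ← Complex.exp_add]
    · simp [Matrix.det_fin_two, ← Complex.exp_add]⟩

/-! ### The irreducible representations of SU(2) and their characters -/

/-- The linear substitution `X_i ↦ ∑ k, g k i X_k` on polynomials in two variables. -/
def subst (g : Matrix (Fin 2) (Fin 2) ℂ) :
    MvPolynomial (Fin 2) ℂ →ₐ[ℂ] MvPolynomial (Fin 2) ℂ :=
  MvPolynomial.aeval fun i => ∑ k, g k i • MvPolynomial.X k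

lemma subst_mem (g : Matrix (Fin 2) (Fin 2) ℂ) {j : ℕ} {p : MvPolynomial (Fin 2) ℂ}
    (hp : p ∈ MvPolynomial.homogeneousSubmodule (Fin 2) ℂ j) :
    subst g p ∈ MvPolynomial.homogeneousSubmodule (Fin 2) ℂ j := by
  have h1 : ∀ i : Fin 2, (∑ k, g k i • (MvPolynomial.X k : MvPolynomial (Fin 2) ℂ)) ∈
      MvPolynomial.homogeneousSubmodule (Fin 2) ℂ 1 := fun i =>
    Submodule.sum_mem _ fun k _ => Submodule.smul_mem _ _ (MvPolynomial.isHomogeneous_X ℂ k)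
  have h2 := MvPolynomial.IsHomogeneous.aeval (show p.IsHomogeneous j from hp) _ h1
  rw [one_mul] at h2
  exact h2

lemma subst_one : subst 1 = AlgHom.id ℂ _ := by
  ext i : 1
  simp [subst, Matrix.one_apply]

lemma subst_mul (g h : Matrix (Fin 2) (Fin 2) ℂ) : subst (g * h) = (subst g).comp (subst h) := by
  refine MvPolynomial.algHom_ext fun i => ?_
  rw [AlgHom.comp_apply]
  simp only [subst, Matrix.mul_apply, MvPolynomial.aeval_X, Fin.sum_univ_two, map_add, map_smul,
    smul_add, add_smul, smul_smul]
  rw [mul_comm (g 0 0), mul_comm (g 1 0), mul_comm (g 0 1), mul_comm (g 1 1)]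
  abel

/-- The representation of dimension `j + 1` of `SU(2)`, i.e. the `j`-th symmetric power of `ℂ²`,
realised on homogeneous polynomials of degree `j` in two variables. -/
def spinRep (j : ℕ) : Representation ℂ SU2 (MvPolynomial.homogeneousSubmodule (Fin 2) ℂ j) where
  toFun g := (subst (g : Matrix (Fin 2) (Fin 2) ℂ)).toLinearMap.restrict fun _ hp =>
    subst_mem _ hp
  map_one' := by
    refine LinearMap.ext fun p => Subtype.ext ?_
    simp [subst_one]
  map_mul' g h := by
    refine LinearMap.ext fun p => Subtype.ext ?_
    exact DFunLike.congr_fun (subst_mul g h) (p : MvPolynomial (Fin 2) ℂ)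

/-- The character `χ_j` of the irreducible representation of dimension `j + 1`. -/
def chi (j : ℕ) (g : SU2) : ℂ := (spinRep j).character g

/-! ### The quantum double D(SU(2)) = ℂ[SU(2)] ⊗ F(SU(2)) -/

/-- The map `f ↦ f ∘ Ad_y`, where `Ad_y a = y a y⁻¹`. -/
def adPull (y : SU2) : C(SU2, ℂ) →⋆ₐ[ℂ] C(SU2, ℂ) :=
  ContinuousMap.compStarAlgHom' ℂ ℂ ⟨fun a => y * a * y⁻¹, by fun_prop⟩

@[simp] lemma adPull_apply (y : SU2) (f : C(SU2, ℂ)) (a : SU2) :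
    adPull y f a = f (y * a * y⁻¹) := rfl

/-- The quantum double of `ℂ[SU(2)]`.  The vector space `ℂ[SU(2)] ⊗ F(SU(2))`, where `F(SU(2))` is
the algebra of continuous functions, is realised as the space of finitely supported functions from
`SU(2)` to `F(SU(2))`: the tensor `x ⊗ f` is the function with value `f` at `x` and `0` elsewhere. -/
def DSU2 : Type := SU2 →₀ C(SU2, ℂ)

namespace DSU2

instance : AddCommGroup DSU2 := inferInstanceAs (AddCommGroup (SU2 →₀ C(SU2, ℂ)))

instance : Module ℂ DSU2 := inferInstanceAs (Module ℂ (SU2 →₀ C(SU2, ℂ)))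

instance : CoeFun DSU2 fun _ => SU2 → C(SU2, ℂ) := ⟨fun X => (show SU2 →₀ C(SU2, ℂ) from X)⟩

/-- The linear map `f ↦ x ⊗ f`. -/
def tensL (x : SU2) : C(SU2, ℂ) →ₗ[ℂ] DSU2 := Finsupp.lsingle x

/-- The element `x ⊗ f`. -/
def tens (x : SU2) (f : C(SU2, ℂ)) : DSU2 := tensL x f

/-- Linear maps out of `D(SU(2))`: the linear map sending `x ⊗ f` to `T x f`. -/
def lift {V : Type*} [AddCommGroup V] [Module ℂ V] (T : SU2 → C(SU2, ℂ) →ₗ[ℂ] V) : DSU2 →ₗ[ℂ] V :=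
  Finsupp.lsum ℂ T

@[simp] lemma lift_tens {V : Type*} [AddCommGroup V] [Module ℂ V] (T : SU2 → C(SU2, ℂ) →ₗ[ℂ] V)
    (x : SU2) (f : C(SU2, ℂ)) : lift T (tens x f) = T x f :=
  Finsupp.sum_single_index (map_zero _)

lemma induction {p : DSU2 → Prop} (X : DSU2) (h0 : p 0) (hadd : ∀ X Y, p X → p Y → p (X + Y))
    (ht : ∀ x f, p (tens x f)) : p X :=
  Finsupp.induction_linear X h0 hadd ht

/-- The product, as a bilinear map: `(x ⊗ f) (y ⊗ g) = xy ⊗ (f ∘ Ad_y) g`. -/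
def mulL : DSU2 →ₗ[ℂ] DSU2 →ₗ[ℂ] DSU2 :=
  lift fun x => (lift fun y => (((LinearMap.mul ℂ C(SU2, ℂ)).compr₂ (tensL (x * y))) ∘ₗ
    (adPull y).toAlgHom.toLinearMap).flip).flip

instance : Mul DSU2 := ⟨fun X Y => mulL X Y⟩

instance : One DSU2 := ⟨tens 1 1⟩

lemma mul_def (X Y : DSU2) : X * Y = mulL X Y := rfl

lemma one_def : (1 : DSU2) = tens 1 1 := rfl

@[simp] lemma tens_mul_tens (x y : SU2) (f g : C(SU2, ℂ)) :
    tens x f * tens y g = tens (x * y) (adPull y f * g) := by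
  rw [mul_def, mulL, lift_tens, LinearMap.flip_apply, lift_tens]
  rfl

instance : Ring DSU2 :=
  { (inferInstance : AddCommGroup DSU2), (inferInstance : Mul DSU2), (inferInstance : One DSU2) with
    left_distrib := fun X Y Z => map_add (mulL X) Y Z
    right_distrib := fun X Y Z => by simp only [mul_def, map_add, LinearMap.add_apply]
    zero_mul := fun X => by simp only [mul_def, map_zero, LinearMap.zero_apply]
    mul_zero := fun X => map_zero (mulL X)
    mul_assoc := fun X Y Z => by
      simp only [mul_def]
      induction X using DSU2.induction with
      | h0 => simp
      | hadd X X' hX hX' => simp only [map_add, LinearMap.add_apply, hX, hX']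
      | ht x f =>
      induction Y using DSU2.induction with
      | h0 => simp
      | hadd X X' hX hX' => simp only [map_add, LinearMap.add_apply, hX, hX']
      | ht y g =>
      induction Z using DSU2.induction with
      | h0 => simp
      | hadd X X' hX hX' => simp only [map_add, hX, hX']
      | ht z k =>
      simp only [← mul_def, tens_mul_tens, mul_assoc]
      congr 1
      ext a
      simp [mul_assoc]
    one_mul := fun X => by
      rw [mul_def]
      induction X using DSU2.induction with
      | h0 => simp
      | hadd X X' hX hX' => simp only [map_add, hX, hX']
      | ht x f =>
      rw [← mul_def, one_def, tens_mul_tens, one_mul]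
      congr 1
      ext a
      simp
    mul_one := fun X => by
      rw [mul_def]
      induction X using DSU2.induction with
      | h0 => simp
      | hadd X X' hX hX' => simp only [map_add, LinearMap.add_apply, hX, hX']
      | ht x f =>
      rw [← mul_def, one_def, tens_mul_tens, mul_one]
      congr 1
      ext a
      simp }

instance : Algebra ℂ DSU2 :=
  Algebra.ofModule
    (fun c X Y => by simp only [mul_def, map_smul, LinearMap.smul_apply])
    (fun c X Y => by simp only [mul_def, map_smul])

/-- The involution: `x* = x⁻¹` on `SU(2)` and complex conjugation on functions, that is
`(x ⊗ f)* = (1 ⊗ f̄) (x⁻¹ ⊗ 1) = x⁻¹ ⊗ (f̄ ∘ Ad_{x⁻¹})`. -/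
def starAdd : DSU2 →+ DSU2 :=
  Finsupp.liftAddHom fun x : SU2 =>
    ((tensL x⁻¹).toAddMonoidHom.comp ((adPull x⁻¹).toAlgHom.toLinearMap.toAddMonoidHom)).comp
      (starAddEquiv (R := C(SU2, ℂ))).toAddMonoidHom

instance : Star DSU2 := ⟨fun X => starAdd X⟩

lemma star_def (X : DSU2) : star X = starAdd X := rfl

@[simp] lemma star_tens (x : SU2) (f : C(SU2, ℂ)) :
    star (tens x f) = tens x⁻¹ (adPull x⁻¹ (star f)) :=
  Finsupp.liftAddHom_apply_single _ x f

instance : StarRing DSU2 where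
  star_involutive X := by
    induction X using DSU2.induction with
    | h0 => simp only [star_def, map_zero]
    | hadd X Y hX hY => simp only [star_def, map_add] at *; rw [hX, hY]
    | ht x f =>
      rw [star_tens, star_tens, inv_inv]
      congr 1
      ext a
      simp [mul_assoc]
  star_add X Y := map_add starAdd X Y
  star_mul X Y := by
    induction X using DSU2.induction with
    | h0 => simp only [zero_mul, mul_zero, star_def, map_zero]
    | hadd X X' hX hX' =>
      simp only [star_def] at *
      rw [add_mul, map_add, map_add, mul_add, hX, hX']
    | ht x f =>
    induction Y using DSU2.induction with
    | h0 => simp only [zero_mul, mul_zero, star_def, map_zero]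
    | hadd X X' hX hX' =>
      simp only [star_def] at *
      rw [mul_add, map_add, map_add, add_mul, hX, hX']
    | ht y g =>
      simp only [star_tens, tens_mul_tens, mul_inv_rev]
      congr 1
      ext a
      simp [mul_assoc, mul_comm]

/-- The map `f ↦ (a ↦ f (x⁻¹ a⁻¹ x))`. -/
def invPull (x : SU2) : C(SU2, ℂ) →⋆ₐ[ℂ] C(SU2, ℂ) :=
  ContinuousMap.compStarAlgHom' ℂ ℂ
    ⟨fun a => x⁻¹ * a⁻¹ * x, (continuous_const.mul continuous_inv).mul continuous_const⟩

@[simp] lemma invPull_apply (x : SU2) (f : C(SU2, ℂ)) (a : SU2) :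
    invPull x f a = f (x⁻¹ * a⁻¹ * x) := rfl

/-- The antipode: `S (x ⊗ f) = x⁻¹ ⊗ (a ↦ f (x⁻¹ a⁻¹ x))`. -/
def antipode : DSU2 →ₗ[ℂ] DSU2 :=
  lift fun x => tensL x⁻¹ ∘ₗ (invPull x).toAlgHom.toLinearMap

lemma antipode_tens (x : SU2) (f : C(SU2, ℂ)) :
    antipode (tens x f) = tens x⁻¹ (invPull x f) := by
  rw [antipode, lift_tens]
  rfl

/-- The element `p ⊗ g` of the dual `D(SU(2))*`, for `p ∈ F(SU(2))` and `g ∈ SU(2)`: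
`⟨p ⊗ g, x ⊗ f⟩ = p(x) f(g)`. -/
def dualTens (p : C(SU2, ℂ)) (g : SU2) : DSU2 →ₗ[ℂ] ℂ :=
  lift fun x => p x • (ContinuousMap.evalAlgHom ℂ ℂ g).toLinearMap

lemma dualTens_tens (p : C(SU2, ℂ)) (g x : SU2) (f : C(SU2, ℂ)) :
    dualTens p g (tens x f) = p x * f g := by
  rw [dualTens, lift_tens]
  rfl

end DSU2

/-! ### Unitary representations of D(SU(2)) on Hilbert spaces

A unitary representation of `D(SU(2))` on a Hilbert space `H` is a unital `*`-homomorphism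
`DSU2 →⋆ₐ[ℂ] (H →L[ℂ] H)`. -/

section Representations

variable {H : Type*} [NormedAddCommGroup H] [InnerProductSpace ℂ H] [CompleteSpace H]

/-- The action of the group element `x ∈ SU(2) ⊂ ℂ[SU(2)] ⊂ D(SU(2))`, i.e. of `x ⊗ 1`. -/
def groupAct (ρ : DSU2 →⋆ₐ[ℂ] (H →L[ℂ] H)) (x : SU2) : H →L[ℂ] H := ρ (DSU2.tens x 1)

/-- The space of `SU(2)`-invariant vectors. -/
def invVectors (ρ : DSU2 →⋆ₐ[ℂ] (H →L[ℂ] H)) : Submodule ℂ H where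
  carrier := {v | ∀ x, groupAct ρ x v = v}
  add_mem' hv hw x := by rw [map_add, hv x, hw x]
  zero_mem' x := map_zero _
  smul_mem' c v hv x := by rw [map_smul, hv x]

/-- The space of continuous linear forms which are `SU(2)`-invariant. -/
def invForms (ρ : DSU2 →⋆ₐ[ℂ] (H →L[ℂ] H)) : Submodule ℂ (H →L[ℂ] ℂ) where
  carrier := {φ | ∀ x v, φ (groupAct ρ x v) = φ v}
  add_mem' hφ hψ x v := by
    rw [add_apply, hφ x v, hψ x v, add_apply]
  zero_mem' x v := rfl
  smul_mem' c φ hφ x v := by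
    rw [smul_apply, hφ x v, smul_apply]

/-- Topological irreducibility: `H ≠ 0` and there is no non-trivial closed invariant subspace. -/
def IsIrreducibleRep (ρ : DSU2 →⋆ₐ[ℂ] (H →L[ℂ] H)) : Prop :=
  Nontrivial H ∧ ∀ W : Submodule ℂ H, IsClosed (W : Set H) →
    (∀ X, ∀ v ∈ W, ρ X v ∈ W) → W = ⊥ ∨ W = ⊤

/-- `E ⊆ H` is an irreducible (finite-dimensional, continuous) representation of `SU(2)`. -/
structure IsGroupIrrep (ρ : DSU2 →⋆ₐ[ℂ] (H →L[ℂ] H)) (E : Submodule ℂ H) : Prop where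
  finiteDimensional : FiniteDimensional ℂ E
  invariant : ∀ x, ∀ v ∈ E, groupAct ρ x v ∈ E
  continuous : ∀ v ∈ E, Continuous fun x => groupAct ρ x v
  ne_bot : E ≠ ⊥
  irreducible : ∀ W ≤ E, (∀ x, ∀ v ∈ W, groupAct ρ x v ∈ W) → W = ⊥ ∨ W = E

/-- Simple representations of the quantum double. -/
structure IsSimple (ρ : DSU2 →⋆ₐ[ℂ] (H →L[ℂ] H)) : Prop where
  irreducible : IsIrreducibleRep ρ
  /-- `ρ` restricted to `SU(2)` is an orthogonal (Hilbert) direct sum of irreducibles. -/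
  decomposes : ∃ S : Set (Submodule ℂ H), (∀ E ∈ S, IsGroupIrrep ρ E) ∧
    S.Pairwise (fun E E' => E ⟂ E') ∧ (sSup S).topologicalClosure = ⊤
  /-- The trivial representation of `SU(2)` has multiplicity one. -/
  multiplicity_one : Module.finrank ℂ (invVectors ρ) = 1
  /-- The space of invariant linear forms is one-dimensional. -/
  forms_one : Module.finrank ℂ (invForms ρ) = 1
  /-- The space of invariant linear forms is not contained in the annihilator of the
  invariant vectors. -/
  forms_pairing : ∃ φ ∈ invForms ρ, ∃ ω ∈ invVectors ρ, φ ω ≠ 0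

/-- Unitary equivalence of representations. -/
def UnitarilyEquivalent {H' : Type*} [NormedAddCommGroup H'] [InnerProductSpace ℂ H']
    [CompleteSpace H'] (ρ : DSU2 →⋆ₐ[ℂ] (H →L[ℂ] H)) (ρ' : DSU2 →⋆ₐ[ℂ] (H' →L[ℂ] H')) : Prop :=
  ∃ U : H ≃ₗᵢ[ℂ] H', ∀ X v, U (ρ X v) = ρ' X (U v)

/-- `ω` is a unit invariant vector and `φ` an invariant linear form with `φ(ω) = 1`. -/
structure IsNormalizedPair (ρ : DSU2 →⋆ₐ[ℂ] (H →L[ℂ] H)) (φ : H →L[ℂ] ℂ) (ω : H) : Prop where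
  vec_mem : ω ∈ invVectors ρ
  norm_vec : ‖ω‖ = 1
  form_mem : φ ∈ invForms ρ
  pairing : φ ω = 1

/-- The symmetric kernel `K = ⟨φ | ρ(·) | ω⟩ ∈ D(SU(2))*`. -/
def symKernel (ρ : DSU2 →⋆ₐ[ℂ] (H →L[ℂ] H)) (φ : H →L[ℂ] ℂ) (ω : H) : DSU2 →ₗ[ℂ] ℂ where
  toFun X := φ (ρ X ω)
  map_add' X Y := by simp
  map_smul' c X := by simp

/-- The propagator `(id ⊗ S) Δ(K)` of `K ∈ D(SU(2))*`, as a bilinear form on `D(SU(2))`.  As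
the coproduct and the antipode of `D(SU(2))*` are the transposes of the product and of the antipode
of `D(SU(2))`, it is `(X, Y) ↦ K (X S(Y))`. -/
def propagator (K : DSU2 →ₗ[ℂ] ℂ) : DSU2 →ₗ[ℂ] DSU2 →ₗ[ℂ] ℂ :=
  (LinearMap.mul ℂ DSU2).compr₂ K |>.compl₂ DSU2.antipode

lemma propagator_apply (K : DSU2 →ₗ[ℂ] ℂ) (X Y : DSU2) :
    propagator K X Y = K (X * DSU2.antipode Y) := rfl

/-- The representation `x ⊗ f ↦ π(x) M(f)` of `D(SU(2))` obtained from a unitary representation `π`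
of `SU(2)` and a `*`-representation `M` of `F(SU(2))` such that `M(f) π(x) = π(x) M(f ∘ Ad_x)`. -/
def covariantRep (π : SU2 →* unitary (H →L[ℂ] H)) (M : C(SU2, ℂ) →⋆ₐ[ℂ] (H →L[ℂ] H))
    (hcov : ∀ x f, M f * (π x : H →L[ℂ] H) = π x * M (adPull x f)) : DSU2 →⋆ₐ[ℂ] (H →L[ℂ] H) :=
  let T : DSU2 →ₗ[ℂ] (H →L[ℂ] H) := DSU2.lift fun x =>
    LinearMap.mulLeft ℂ (π x : H →L[ℂ] H) ∘ₗ M.toAlgHom.toLinearMap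
  have hT : ∀ x f, T (DSU2.tens x f) = π x * M f := fun x f => DSU2.lift_tens _ x f
  have h1 : T 1 = 1 := by rw [DSU2.one_def, hT, map_one, map_one]; simp
  have hmul : ∀ X Y, T (X * Y) = T X * T Y := fun X Y => by
    induction X using DSU2.induction with
    | h0 => simp
    | hadd X X' hX hX' => rw [add_mul, map_add, hX, hX', map_add, add_mul]
    | ht x f =>
    induction Y using DSU2.induction with
    | h0 => simp
    | hadd X X' hX hX' => rw [mul_add, map_add, hX, hX', map_add, mul_add]
    | ht y g =>
      rw [DSU2.tens_mul_tens, hT, hT, hT, map_mul, map_mul, Submonoid.coe_mul]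
      have := hcov y f
      calc ((π x : H →L[ℂ] H) * π y) * (M (adPull y f) * M g)
          = π x * ((π y : H →L[ℂ] H) * M (adPull y f)) * M g := by simp only [mul_assoc]
        _ = π x * (M f * (π y : H →L[ℂ] H)) * M g := by rw [this]
        _ = π x * M f * (π y * M g) := by simp only [mul_assoc]
  have hstar : ∀ X, T (star X) = star (T X) := fun X => by
    induction X using DSU2.induction with
    | h0 => simp
    | hadd X X' hX hX' => rw [star_add, map_add, hX, hX', map_add, star_add]
    | ht x f =>
      rw [DSU2.star_tens, hT, hT, ← hcov, star_mul, map_star, map_inv]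
      rfl
  { AlgHom.ofLinearMap T h1 hmul with map_star' := hstar }

lemma covariantRep_tens (π : SU2 →* unitary (H →L[ℂ] H)) (M : C(SU2, ℂ) →⋆ₐ[ℂ] (H →L[ℂ] H))
    (hcov : ∀ x f, M f * (π x : H →L[ℂ] H) = π x * M (adPull x f)) (x : SU2) (f : C(SU2, ℂ)) :
    covariantRep π M hcov (DSU2.tens x f) = π x * M f :=
  DSU2.lift_tens _ x f

/-- The restriction of a `*`-representation to a closed invariant subspace. -/
def restrictRep (ρ : DSU2 →⋆ₐ[ℂ] (H →L[ℂ] H)) (V : Submodule ℂ H) [CompleteSpace V]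
    (hV : ∀ X, ∀ v ∈ V, ρ X v ∈ V) : DSU2 →⋆ₐ[ℂ] (V →L[ℂ] V) where
  toFun X := ((ρ X).comp V.subtypeL).codRestrict V fun v => hV X v v.2
  map_one' := by ext v; simp
  map_mul' X Y := ContinuousLinearMap.ext fun v => Subtype.ext
    (congrArg (fun T : H →L[ℂ] H => T v) (map_mul ρ X Y))
  map_zero' := by ext v; simp
  map_add' X Y := ContinuousLinearMap.ext fun v => Subtype.ext
    (congrArg (fun T : H →L[ℂ] H => T v) (map_add ρ X Y))
  commutes' c := by ext v; simp [Algebra.algebraMap_eq_smul_one]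
  map_star' X := by
    rw [ContinuousLinearMap.star_eq_adjoint, ContinuousLinearMap.eq_adjoint_iff]
    intro v w
    change ⟪ρ (star X) (v : H), (w : H)⟫_ℂ = ⟪(v : H), ρ X (w : H)⟫_ℂ
    rw [map_star, ContinuousLinearMap.star_eq_adjoint, ContinuousLinearMap.adjoint_inner_left]

lemma restrictRep_apply (ρ : DSU2 →⋆ₐ[ℂ] (H →L[ℂ] H)) (V : Submodule ℂ H) [CompleteSpace V]
    (hV : ∀ X, ∀ v ∈ V, ρ X v ∈ V) (X : DSU2) (v : V) :
    (restrictRep ρ V hV X v : H) = ρ X v := rfl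

/-- For `h` in the centre of `SU(2)` and a unitary representation `π` of the centralizer `SU(2)` of
`h`, the representation `x ⊗ f ↦ f(h) π(x)`. -/
def centralRep (h : SU2) (hc : h ∈ Subgroup.center SU2) (π : SU2 →* unitary (H →L[ℂ] H)) :
    DSU2 →⋆ₐ[ℂ] (H →L[ℂ] H) :=
  covariantRep π
    ((StarAlgHom.ofId ℂ (H →L[ℂ] H)).comp (ContinuousMap.evalStarAlgHom ℂ ℂ h)) fun x f => by
      have h1 : x * h * x⁻¹ = h := by
        rw [Subgroup.mem_center_iff.mp hc x, mul_inv_cancel_right]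
      change algebraMap ℂ _ (f h) * _ = _ * algebraMap ℂ _ (f (x * h * x⁻¹))
      rw [h1, Algebra.commutes]

/-- Irreducibility of a unitary representation of the group `SU(2)`. -/
def IsIrreducibleGroupRep (π : SU2 →* unitary (H →L[ℂ] H)) : Prop :=
  Nontrivial H ∧ ∀ W : Submodule ℂ H, IsClosed (W : Set H) →
    (∀ x, ∀ v ∈ W, (π x : H →L[ℂ] H) v ∈ W) → W = ⊥ ∨ W = ⊤

end Representations

/-! ### The representations (θ, s) -/

/-- The Hilbert space `L²(SU(2), dg)`. -/
abbrev L2 : Type := Lp ℂ 2 haar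

/-- Left translation `ψ ↦ ψ(x⁻¹ ·)`. -/
def leftT (x : SU2) : L2 →L[ℂ] L2 :=
  (Lp.compMeasurePreservingₗᵢ ℂ (x⁻¹ * ·)
    (measurePreserving_mul_left haar x⁻¹)).toContinuousLinearMap

/-- Right translation `ψ ↦ ψ(· n)`. -/
def rightT (n : SU2) : L2 →L[ℂ] L2 :=
  (Lp.compMeasurePreservingₗᵢ ℂ (· * n)
    (measurePreserving_mul_right haar n)).toContinuousLinearMap

/-- Multiplication by a continuous function. -/
def mulOp (f : C(SU2, ℂ)) : L2 →L[ℂ] L2 :=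
  (ContinuousLinearMap.mul ℂ ℂ).holderL haar ⊤ 2 2 (ContinuousMap.toLp ⊤ haar ℂ f)

lemma leftT_apply (x : SU2) (ψ : L2) : leftT x ψ =ᵐ[haar] fun a => ψ (x⁻¹ * a) :=
  Lp.coeFn_compMeasurePreserving ψ (measurePreserving_mul_left haar x⁻¹)

lemma rightT_apply (n : SU2) (ψ : L2) : rightT n ψ =ᵐ[haar] fun a => ψ (a * n) :=
  Lp.coeFn_compMeasurePreserving ψ (measurePreserving_mul_right haar n)

lemma mulOp_apply (f : C(SU2, ℂ)) (ψ : L2) : mulOp f ψ =ᵐ[haar] fun a => f a * ψ a := by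
  filter_upwards [(ContinuousLinearMap.mul ℂ ℂ).coeFn_holder (r := 2)
    (ContinuousMap.toLp ⊤ haar ℂ f) ψ, ContinuousMap.coeFn_toLp (p := ⊤) (𝕜 := ℂ) haar f]
    with a h1 h2
  exact h1.trans (by rw [h2]; rfl)

lemma ae_left {p : SU2 → Prop} (x : SU2) (h : ∀ᵐ a ∂haar, p a) : ∀ᵐ a ∂haar, p (x * a) :=
  (measurePreserving_mul_left haar x).quasiMeasurePreserving.ae h

lemma ae_right {p : SU2 → Prop} (n : SU2) (h : ∀ᵐ a ∂haar, p a) : ∀ᵐ a ∂haar, p (a * n) :=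
  (measurePreserving_mul_right haar n).quasiMeasurePreserving.ae h

lemma leftT_mul (x y : SU2) : leftT (x * y) = leftT x * leftT y := by
  refine ContinuousLinearMap.ext fun ψ => Lp.ext ?_
  filter_upwards [leftT_apply (x * y) ψ, leftT_apply x (leftT y ψ),
    ae_left x⁻¹ (leftT_apply y ψ)] with a h1 h2 h3
  rw [h1, mul_apply_eq_comp, h2, h3, mul_inv_rev, mul_assoc]

lemma leftT_one : leftT 1 = 1 := by
  refine ContinuousLinearMap.ext fun ψ => Lp.ext ?_
  filter_upwards [leftT_apply 1 ψ] with a h1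
  rw [h1, inv_one, one_mul, one_apply_eq_self]

lemma star_leftT (x : SU2) : star (leftT x) = leftT x⁻¹ := by
  rw [ContinuousLinearMap.star_eq_adjoint, eq_comm, ContinuousLinearMap.eq_adjoint_iff]
  intro v w
  have h : leftT x (leftT x⁻¹ v) = v := by
    rw [← mul_apply_eq_comp, ← leftT_mul, mul_inv_cancel, leftT_one,
      one_apply_eq_self]
  conv_rhs => rw [← h]
  let U : L2 →ₗᵢ[ℂ] L2 := Lp.compMeasurePreservingₗᵢ ℂ (x⁻¹ * ·)
    (measurePreserving_mul_left haar x⁻¹)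
  exact (U.inner_map_map (leftT x⁻¹ v) w).symm

/-- The left regular representation of `SU(2)`. -/
def leftRep : SU2 →* unitary (L2 →L[ℂ] L2) where
  toFun x := ⟨leftT x, Unitary.mem_iff.mpr
    ⟨by rw [star_leftT, ← leftT_mul, inv_mul_cancel, leftT_one],
     by rw [star_leftT, ← leftT_mul, mul_inv_cancel, leftT_one]⟩⟩
  map_one' := Subtype.ext leftT_one
  map_mul' x y := Subtype.ext (leftT_mul x y)

/-- Pull-back along the orbit map: `f ↦ (a ↦ f (a h a⁻¹))`. -/
def orbitPull (h : SU2) : C(SU2, ℂ) →⋆ₐ[ℂ] C(SU2, ℂ) :=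
  ContinuousMap.compStarAlgHom' ℂ ℂ
    ⟨fun a => a * h * a⁻¹, (continuous_id.mul continuous_const).mul continuous_inv⟩

@[simp] lemma orbitPull_apply (h : SU2) (f : C(SU2, ℂ)) (a : SU2) :
    orbitPull h f a = f (a * h * a⁻¹) := rfl

/-- The representation of `F(SU(2))` on `L²(SU(2))` by multiplication operators. -/
def mulRep : C(SU2, ℂ) →⋆ₐ[ℂ] (L2 →L[ℂ] L2) where
  toFun := mulOp
  map_one' := by
    refine ContinuousLinearMap.ext fun ψ => Lp.ext ?_
    filter_upwards [mulOp_apply 1 ψ] with a h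
    rw [h, ContinuousMap.one_apply, one_mul, one_apply_eq_self]
  map_mul' f g := by
    refine ContinuousLinearMap.ext fun ψ => Lp.ext ?_
    filter_upwards [mulOp_apply (f * g) ψ, mulOp_apply f (mulOp g ψ), mulOp_apply g ψ]
      with a h1 h2 h3
    rw [h1, mul_apply_eq_comp, h2, h3, ContinuousMap.mul_apply, mul_assoc]
  map_zero' := by simp [mulOp]
  map_add' f g := by simp [mulOp]
  commutes' c := by
    refine ContinuousLinearMap.ext fun ψ => Lp.ext ?_
    rw [Algebra.algebraMap_eq_smul_one, Algebra.algebraMap_eq_smul_one]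
    filter_upwards [mulOp_apply (c • 1) ψ, Lp.coeFn_smul c ψ] with a h1 h2
    rw [h1]
    refine Eq.trans ?_ h2.symm
    simp
  map_star' f := by
    rw [ContinuousLinearMap.star_eq_adjoint, ContinuousLinearMap.eq_adjoint_iff]
    intro v w
    rw [L2.inner_def, L2.inner_def]
    refine integral_congr_ae ?_
    filter_upwards [mulOp_apply (star f) v, mulOp_apply f w] with a h1 h2
    rw [h1, h2]
    simp
    ring

/-- The representation `[ρ(x ⊗ f) ψ](a) = f (x⁻¹ a h a⁻¹ x) ψ(x⁻¹ a)` of `D(SU(2))` on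
`L²(SU(2))`. -/
def orbitRep (h : SU2) : DSU2 →⋆ₐ[ℂ] (L2 →L[ℂ] L2) :=
  covariantRep leftRep (mulRep.comp (orbitPull h)) fun x f => by
    refine ContinuousLinearMap.ext fun ψ => Lp.ext ?_
    change mulOp (orbitPull h f) (leftT x ψ) =ᵐ[haar]
      leftT x (mulOp (orbitPull h (adPull x f)) ψ)
    filter_upwards [mulOp_apply (orbitPull h f) (leftT x ψ), leftT_apply x ψ,
      leftT_apply x (mulOp (orbitPull h (adPull x f)) ψ),
      ae_left x⁻¹ (mulOp_apply (orbitPull h (adPull x f)) ψ)] with a h1 h2 h3 h4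
    rw [h1, h2, h3, h4]
    simp [mul_assoc]

lemma orbitRep_tens (h x : SU2) (f : C(SU2, ℂ)) (ψ : L2) :
    orbitRep h (DSU2.tens x f) ψ =ᵐ[haar]
      fun a => f (x⁻¹ * a * h * a⁻¹ * x) * ψ (x⁻¹ * a) := by
  rw [orbitRep, covariantRep_tens]
  change leftT x (mulOp (orbitPull h f) ψ) =ᵐ[haar] _
  filter_upwards [leftT_apply x (mulOp (orbitPull h f) ψ),
    ae_left x⁻¹ (mulOp_apply (orbitPull h f) ψ)] with a h1 h2
  rw [h1, h2]
  simp [mul_assoc]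

/-- The space `𝒱_{θ,s}` of the `ψ ∈ L²(SU(2))` such that `ψ(a n) = χ_s(n) ψ(a)` for all `n` in the
centralizer of `h_θ`.  If `h_θ` is not central, this centralizer is the group `U(1)` of the matrices
`n = diag(e^{iξ}, e^{-iξ})`, and `χ_s(n) = e^{isξ}`; if `s = 0`, then `χ_s = 1` in all cases. -/
def vSpace (θ : ℝ) (s : ℤ) : Submodule ℂ L2 where
  carrier := {ψ | ∀ n ∈ Subgroup.centralizer {hTheta θ},
    rightT n ψ = ((n : Matrix (Fin 2) (Fin 2) ℂ) 0 0) ^ s • ψ}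
  add_mem' hv hw n hn := by rw [map_add, hv n hn, hw n hn, smul_add]
  zero_mem' n _ := by rw [map_zero, smul_zero]
  smul_mem' c v hv n hn := by rw [map_smul, hv n hn, smul_comm]

lemma isClosed_vSpace (θ : ℝ) (s : ℤ) : IsClosed (vSpace θ s : Set L2) := by
  have : (vSpace θ s : Set L2) = ⋂ n ∈ Subgroup.centralizer {hTheta θ},
      {ψ | rightT n ψ = ((n : Matrix (Fin 2) (Fin 2) ℂ) 0 0) ^ s • ψ} := by
    ext ψ
    simp only [Set.mem_iInter]
    rfl
  rw [this]
  exact isClosed_biInter fun n _ => isClosed_eq (rightT n).continuous (continuous_const_smul _)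

instance (θ : ℝ) (s : ℤ) : CompleteSpace (vSpace θ s) :=
  (isClosed_vSpace θ s).completeSpace_coe

lemma rightT_orbitRep_tens {h n : SU2} (hn : n ∈ Subgroup.centralizer {h}) (x : SU2)
    (f : C(SU2, ℂ)) (ψ : L2) :
    rightT n (orbitRep h (DSU2.tens x f) ψ) = orbitRep h (DSU2.tens x f) (rightT n ψ) := by
  have h0 : n * h * n⁻¹ = h := by
    rw [Subgroup.mem_centralizer_singleton_iff.mp hn, mul_inv_cancel_right]
  refine Lp.ext ?_
  filter_upwards [rightT_apply n (orbitRep h (DSU2.tens x f) ψ),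
    ae_right n (orbitRep_tens h x f ψ), orbitRep_tens h x f (rightT n ψ),
    ae_left x⁻¹ (rightT_apply n ψ)] with a h1 h2 h3 h4
  rw [h1, h2, h3, h4]
  have h5 : x⁻¹ * (a * n) * h * (a * n)⁻¹ * x = x⁻¹ * a * h * a⁻¹ * x := by
    calc x⁻¹ * (a * n) * h * (a * n)⁻¹ * x = x⁻¹ * a * (n * h * n⁻¹) * a⁻¹ * x := by group
      _ = _ := by rw [h0]
  rw [h5, ← mul_assoc]

lemma orbitRep_mem_vSpace (θ : ℝ) (s : ℤ) (X : DSU2) (ψ : L2) (hψ : ψ ∈ vSpace θ s) :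
    orbitRep (hTheta θ) X ψ ∈ vSpace θ s := by
  induction X using DSU2.induction with
  | h0 => simp
  | hadd X Y hX hY =>
    rw [map_add, add_apply]
    exact Submodule.add_mem _ hX hY
  | ht x f =>
    intro n hn
    rw [rightT_orbitRep_tens hn, hψ n hn, map_smul]

/-- The representation `(θ, s)` of `D(SU(2))` on `𝒱_{θ,s}`:
`[ρ(x ⊗ f) ψ](a) = f (x⁻¹ a h_θ a⁻¹ x) ψ(x⁻¹ a)`. -/
def rep (θ : ℝ) (s : ℤ) : DSU2 →⋆ₐ[ℂ] (vSpace θ s →L[ℂ] vSpace θ s) :=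
  restrictRep (orbitRep (hTheta θ)) (vSpace θ s) (orbitRep_mem_vSpace θ s)

/-- The constant function `1`, as a vector of `𝒱_{θ,0}`. -/
def omegaOne (θ : ℝ) : vSpace θ 0 :=
  ⟨ContinuousMap.toLp 2 haar ℂ 1, fun n _ => by
    rw [zpow_zero, one_smul]
    refine Lp.ext ?_
    have h := ContinuousMap.coeFn_toLp (p := 2) (𝕜 := ℂ) haar (1 : C(SU2, ℂ))
    filter_upwards [rightT_apply n (ContinuousMap.toLp 2 haar ℂ 1), h, ae_right n h] with a h1 h2 h3
    rw [h1, h3, h2]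
    rfl⟩

/-! ### Test functions and the delta function of a conjugacy class -/

/-- `f` is smooth on `SU(2)`, i.e. the restriction of a smooth function of the matrix entries. -/
def IsSmooth (f : C(SU2, ℂ)) : Prop :=
  ∃ F : (Fin 2 → Fin 2 → ℂ) → ℂ, ContDiff ℝ ((⊤ : ℕ∞) : WithTop ℕ∞) F ∧
    ∀ g : SU2, f g = F fun i j => (g : Matrix (Fin 2) (Fin 2) ℂ) i j

/-- `X` belongs to `ℂ[SU(2)] ⊗ C^∞(SU(2))`. -/
def IsSmoothElement (X : DSU2) : Prop := ∀ x, IsSmooth (X x)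

/-- `m` is the normalised delta measure `δ(g) dg` of the conjugacy class of `h`: a
conjugation-invariant probability measure carried by this class. -/
structure IsClassDelta (h : SU2) (m : Measure SU2) : Prop where
  prob : IsProbabilityMeasure m
  conj_invariant : ∀ u : SU2, m.map (fun g => u * g * u⁻¹) = m
  carried : m {g | IsConj h g}ᶜ = 0

end SU2Double

end

open SU2Double

universe u

namespace SU2Double

/-! ### Conjugacy classes of SU(2) -/

/-! A representation of the double is a covariant pair: a unitary action of `SU(2)` and a
`*`-representation of `F(SU(2))`, the latter automatically contractive. An invariant vector `ω` of
an irreducible representation is cyclic already for `F(SU(2))`, because group elements can be moved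
to the right, where they fix `ω`. By uniqueness of the GNS construction
(`unitarilyEquivalent_of_inner`) the representation is therefore determined by the state `f ↦ ⟨ω, f
ω⟩`.

This state is computed once and for all. Functions of the trace are central in the double, so by
irreducibility only one conjugacy class contributes (`IsIrreducibleRep.exists_angle`). The state is
also conjugation-invariant, hence it is the orbital integral over that class
(`inner_funRep_eq_integral`). This gives the classification. Invariant forms are inner products with
invariant vectors, so it also gives the kernel, and with left invariance of Haar measure the
propagator.

Conversely, `(θ, 0)` is irreducible (`isIrreducibleRep_rep`): if `w` is orthogonal to everything
generated by `v`, then averaging over the centralizer shows that every translate of `w` has product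
zero with `v` almost everywhere, and Fubini forces `w = 0` or `v = 0`. Its invariant vectors are the
constants, and for `s ≠ 0` no nonzero constant lies in the space. The decomposition into
irreducibles of `SU(2)` comes from density of the functions that are finite under conjugation,
together with Zorn's lemma.

For the Fourier expansion (`hasSum_chi_orbit`), the orbital integral of a smooth function is a
smooth, even, `2π`-periodic function of `θ`, so its Fourier coefficients decay rapidly. Summation by
parts with `χ_{j+2} - χ_j = e^{i(j+2)θ} + e^{-i(j+2)θ}` turns the cosine series into a character
series, whose coefficients are identified by orthonormality of the characters. -/

open ComplexConjugate in
/-- The element of `SU(2)` whose first column is the unit vector `(a, b)`. -/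
noncomputable def ofColumn (a b : ℂ) (hab : ‖a‖ ^ 2 + ‖b‖ ^ 2 = 1) : SU2 :=
  ⟨!![a, -conj b; b, conj a], by
    have h : a * conj a + b * conj b = 1 := by
      rw [Complex.mul_conj', Complex.mul_conj']; exact_mod_cast hab
    rw [Matrix.mem_specialUnitaryGroup_iff, Matrix.mem_unitaryGroup_iff]
    constructor
    · ext i j
      fin_cases i <;> fin_cases j <;> simp [Matrix.mul_apply, Matrix.star_apply] <;>
        first | linear_combination h | ring
    · rw [Matrix.det_fin_two]; simp; linear_combination h⟩

-- For a unitary matrix of determinant one the adjoint equals the inverse, which is the adjugate;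
-- comparing entries gives both relations.
open ComplexConjugate in
lemma entries (g : SU2) : g.1 1 1 = conj (g.1 0 0) ∧ g.1 1 0 = -conj (g.1 0 1) := by
  have h1 : g.1 * star g.1 = 1 :=
    Matrix.mem_unitaryGroup_iff.mp (Matrix.mem_specialUnitaryGroup_iff.mp g.2).1
  have h2 : g.1.det = 1 := (Matrix.mem_specialUnitaryGroup_iff.mp g.2).2
  have h3 : star g.1 = g.1.adjugate := by
    calc star g.1 = (g.1.adjugate * g.1) * star g.1 := by rw [Matrix.adjugate_mul, h2]; simp
      _ = g.1.adjugate := by rw [mul_assoc, h1, mul_one]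
  have h4 := congrFun (congrFun h3 0) 0
  have h5 := congrFun (congrFun h3 1) 0
  simp [Matrix.adjugate_fin_two, Matrix.star_apply] at h4 h5
  exact ⟨h4.symm, by rw [h5]; simp⟩

lemma norm_entries (g : SU2) : ‖g.1 0 0‖ ^ 2 + ‖g.1 0 1‖ ^ 2 = 1 := by
  have h2 : g.1.det = 1 := (Matrix.mem_specialUnitaryGroup_iff.mp g.2).2
  rw [Matrix.det_fin_two, (entries g).1, (entries g).2, Complex.mul_conj', mul_neg, sub_neg_eq_add,
    Complex.mul_conj'] at h2
  exact_mod_cast h2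

lemma norm_entry_le_one (g : SU2) : ‖g.1 0 0‖ ≤ 1 := by
  nlinarith [norm_entries g, norm_nonneg (g.1 0 0), sq_nonneg ‖g.1 0 1‖]

lemma hTheta_zero_zero (θ : ℝ) : (hTheta θ).1 0 0 = Complex.exp (θ * Complex.I) := rfl

lemma hTheta_add (θ ξ : ℝ) : hTheta (θ + ξ) = hTheta θ * hTheta ξ := by
  refine Subtype.ext ?_
  rw [Submonoid.coe_mul]
  ext i j
  fin_cases i <;> fin_cases j <;>
    simp [hTheta, Matrix.mul_apply, ← Complex.exp_add] <;> congr 1 <;> ring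

lemma hTheta_mem_centralizer (θ ξ : ℝ) : hTheta ξ ∈ Subgroup.centralizer {hTheta θ} := by
  rw [Subgroup.mem_centralizer_singleton_iff, ← hTheta_add, ← hTheta_add, add_comm]

/-- Half of the trace, a real number. -/
noncomputable def halfTrace : C(SU2, ℝ) :=
  ⟨fun g => (g.1 0 0).re, Complex.continuous_re.comp
    ((continuous_subtype_val).matrix_elem 0 0)⟩

lemma trace_eq (g : SU2) : g.1.trace = 2 * (halfTrace g : ℂ) := by
  rw [Matrix.trace_fin_two, (entries g).1]
  change _ = 2 * (((g.1 0 0).re : ℝ) : ℂ)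
  rw [Complex.add_conj]
  push_cast
  ring

lemma halfTrace_conj (u g : SU2) : halfTrace (u * g * u⁻¹) = halfTrace g := by
  have h : ((u * g * u⁻¹ : SU2)).1.trace = g.1.trace := by
    rw [Submonoid.coe_mul, Matrix.trace_mul_comm, ← Submonoid.coe_mul, inv_mul_cancel_left]
  rw [trace_eq, trace_eq] at h
  exact_mod_cast mul_left_cancel₀ two_ne_zero h

lemma halfTrace_hTheta (θ : ℝ) : halfTrace (hTheta θ) = Real.cos θ := by
  change (Complex.exp (θ * Complex.I)).re = _
  rw [Complex.exp_ofReal_mul_I_re]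

lemma abs_halfTrace_le (g : SU2) : |halfTrace g| ≤ 1 :=
  (Complex.abs_re_le_norm _).trans (norm_entry_le_one g)

open ComplexConjugate in
/-- Diagonalisation in `SU(2)`. -/
lemma exists_conj_hTheta {g : SU2} {θ : ℝ} (h : halfTrace g = Real.cos θ) :
    ∃ u : SU2, g = u * hTheta θ * u⁻¹ := by
  set l := Complex.exp (θ * Complex.I) with hl
  have hll : l * conj l = 1 := by
    rw [Complex.mul_conj', hl, Complex.norm_exp_ofReal_mul_I]; simp
  have hre : g.1 0 0 + conj (g.1 0 0) = l + conj l := by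
    have h1 : l.re = Real.cos θ := by rw [hl, Complex.exp_ofReal_mul_I_re]
    rw [Complex.add_conj, Complex.add_conj, h1, ← h]; rfl
  have hc : Complex.exp (-(θ * Complex.I)) = conj l := by
    rw [hl, ← Complex.exp_conj]; simp
  -- The characteristic polynomial is `t² - 2 cos θ t + 1`, with roots `l` and `conj l`.
  have hdet : (g.1 - l • (1 : Matrix (Fin 2) (Fin 2) ℂ)).det = 0 := by
    have h2 : g.1.det = 1 := (Matrix.mem_specialUnitaryGroup_iff.mp g.2).2
    rw [Matrix.det_fin_two] at h2 ⊢
    simp only [Matrix.sub_apply, Matrix.smul_apply, Matrix.one_apply, smul_eq_mul, (entries g).1]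
      at h2 ⊢
    simp
    linear_combination h2 - l * hre - hll
  obtain ⟨v, hv0, hv⟩ := Matrix.exists_mulVec_eq_zero_iff.mpr hdet
  have hv1 := congrFun hv 0
  have hv2 := congrFun hv 1
  simp [Matrix.mulVec, dotProduct, Fin.sum_univ_two, (entries g).1, (entries g).2] at hv1 hv2
  have hN : 0 < ‖v 0‖ ^ 2 + ‖v 1‖ ^ 2 := by
    by_contra hN
    have h0 : v 0 = 0 := by
      rw [← norm_eq_zero]; nlinarith [sq_nonneg ‖v 0‖, sq_nonneg ‖v 1‖]
    have h1 : v 1 = 0 := by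
      rw [← norm_eq_zero]; nlinarith [sq_nonneg ‖v 0‖, sq_nonneg ‖v 1‖]
    exact hv0 (by ext i; fin_cases i <;> simp [h0, h1])
  set N := ‖v 0‖ ^ 2 + ‖v 1‖ ^ 2
  set r : ℝ := (Real.sqrt N)⁻¹
  have hr : r ^ 2 * N = 1 := by
    rw [inv_pow, Real.sq_sqrt hN.le, inv_mul_cancel₀ hN.ne']
  have hw : ‖(r : ℂ) * v 0‖ ^ 2 + ‖(r : ℂ) * v 1‖ ^ 2 = 1 := by
    rw [norm_mul, norm_mul, Complex.norm_real, mul_pow, mul_pow, Real.norm_eq_abs, sq_abs, ← mul_add]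
    exact hr
  -- The first column is a unit eigenvector for `l`. The second column is then an eigenvector for
  -- `conj l`, by the conjugated eigenvector equations `hv1'` and `hv2'`.
  refine ⟨ofColumn _ _ hw, ?_⟩
  rw [eq_mul_inv_iff_mul_eq]
  refine Subtype.ext ?_
  have hv1' := congrArg conj hv1
  have hv2' := congrArg conj hv2
  simp at hv1' hv2'
  rw [Submonoid.coe_mul, Submonoid.coe_mul]
  ext i j
  fin_cases i <;> fin_cases j <;>
    simp [hTheta, ofColumn, Matrix.mul_apply, Fin.sum_univ_two, (entries g).1, (entries g).2, hc,
      ← hl]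
  · linear_combination (r : ℂ) * hv1
  · linear_combination -(r : ℂ) * hv2'
  · linear_combination (r : ℂ) * hv2
  · linear_combination (r : ℂ) * hv1'

lemma exists_angle (g : SU2) : ∃ θ ∈ Set.Icc 0 Real.pi, ∃ u : SU2, g = u * hTheta θ * u⁻¹ := by
  have h := abs_le.mp (abs_halfTrace_le g)
  refine ⟨Real.arccos (halfTrace g), ⟨Real.arccos_nonneg _, Real.arccos_le_pi _⟩,
    exists_conj_hTheta ?_⟩
  rw [Real.cos_arccos h.1 h.2]

/-- A complex-valued version of `halfTrace`, composed with a continuous function. -/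
noncomputable def traceFun (φ : C(ℝ, ℂ)) : C(SU2, ℂ) := φ.comp halfTrace

lemma traceFun_apply (φ : C(ℝ, ℂ)) (g : SU2) : traceFun φ g = φ (halfTrace g) := rfl

lemma adPull_traceFun (φ : C(ℝ, ℂ)) (y : SU2) : adPull y (traceFun φ) = traceFun φ := by
  ext a
  rw [adPull_apply, traceFun_apply, traceFun_apply, halfTrace_conj]

/-! ### Unitary representations of the quantum double -/

lemma adPull_one (f : C(SU2, ℂ)) : adPull 1 f = f := by ext a; simp

lemma adPull_mul (x y : SU2) (f : C(SU2, ℂ)) : adPull (x * y) f = adPull y (adPull x f) := by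
  ext a; simp [mul_assoc]

/-- Joint continuity curries to continuity for the uniform norm. This makes the orbit map of `f`
Bochner integrable and gives continuity of the group action on the vectors `f ω`. -/
lemma continuous_adPull (f : C(SU2, ℂ)) : Continuous fun y => adPull y f := by
  have h : Continuous fun p : SU2 × SU2 => f (p.1 * p.2 * p.1⁻¹) :=
    f.continuous.comp ((continuous_fst.mul continuous_snd).mul continuous_fst.inv)
  exact (ContinuousMap.curry ⟨_, h⟩).continuous

namespace DSU2

lemma tens_eq_mul (x : SU2) (f : C(SU2, ℂ)) : tens x f = tens x 1 * tens 1 f := by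
  rw [tens_mul_tens, mul_one, map_one, one_mul]

lemma tens_one_mul (y : SU2) (f : C(SU2, ℂ)) : tens 1 f * tens y 1 = tens y (adPull y f) := by
  rw [tens_mul_tens, one_mul, mul_one]

lemma tens_eq_mul' (x : SU2) (f : C(SU2, ℂ)) : tens x f = tens 1 (adPull x⁻¹ f) * tens x 1 := by
  rw [tens_one_mul, ← adPull_mul, inv_mul_cancel, adPull_one]

end DSU2

lemma innerSL_self_of_norm_one {H : Type*} [NormedAddCommGroup H]
    [InnerProductSpace ℂ H] {ω : H} (hω : ‖ω‖ = 1) : innerSL ℂ ω ω = 1 := by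
  rw [innerSL_apply_apply, inner_self_eq_norm_sq_to_K, hω]; simp

section

variable {H : Type*} [NormedAddCommGroup H] [InnerProductSpace ℂ H] [CompleteSpace H]
  {H' : Type*} [NormedAddCommGroup H'] [InnerProductSpace ℂ H'] [CompleteSpace H']

/-- The restriction of a representation of `D(SU(2))` to `F(SU(2))`. -/
noncomputable def funRep (ρ : DSU2 →⋆ₐ[ℂ] (H →L[ℂ] H)) : C(SU2, ℂ) →⋆ₐ[ℂ] (H →L[ℂ] H) where
  toFun f := ρ (DSU2.tens 1 f)
  map_one' := by rw [← DSU2.one_def, map_one]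
  map_mul' f g := by rw [← map_mul, DSU2.tens_mul_tens, one_mul, adPull_one]
  map_zero' := by rw [DSU2.tens, map_zero, map_zero]
  map_add' f g := by rw [← map_add]; congr 1; exact map_add _ _ _
  commutes' c := by
    rw [Algebra.algebraMap_eq_smul_one, Algebra.algebraMap_eq_smul_one, DSU2.tens, map_smul,
      map_smul]
    congr 1
    exact map_one ρ
  map_star' f := by rw [← map_star, DSU2.star_tens, inv_one, adPull_one]

lemma funRep_apply (ρ : DSU2 →⋆ₐ[ℂ] (H →L[ℂ] H)) (f : C(SU2, ℂ)) :
    funRep ρ f = ρ (DSU2.tens 1 f) := rfl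

/-- Automatic continuity: a `*`-homomorphism between C*-algebras is contractive. -/
lemma continuous_funRep (ρ : DSU2 →⋆ₐ[ℂ] (H →L[ℂ] H)) : Continuous (funRep ρ) :=
  AddMonoidHomClass.continuous_of_bound (funRep ρ) 1 fun f => by
    rw [one_mul]; exact NonUnitalStarAlgHom.norm_apply_le (funRep ρ) f

lemma inner_apply (ρ : DSU2 →⋆ₐ[ℂ] (H →L[ℂ] H)) (X : DSU2) (v w : H) :
    ⟪v, ρ X w⟫_ℂ = ⟪ρ (star X) v, w⟫_ℂ := by
  rw [map_star, ContinuousLinearMap.star_eq_adjoint, ContinuousLinearMap.adjoint_inner_left]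

lemma inner_groupAct (ρ : DSU2 →⋆ₐ[ℂ] (H →L[ℂ] H)) (x : SU2) (v w : H) :
    ⟪v, groupAct ρ x w⟫_ℂ = ⟪groupAct ρ x⁻¹ v, w⟫_ℂ := by
  rw [groupAct, inner_apply, DSU2.star_tens, star_one, map_one]; rfl

lemma rho_tens (ρ : DSU2 →⋆ₐ[ℂ] (H →L[ℂ] H)) (x : SU2) (f : C(SU2, ℂ)) :
    ρ (DSU2.tens x f) = groupAct ρ x * funRep ρ f := by
  rw [DSU2.tens_eq_mul, map_mul]; rfl

lemma rho_tens' (ρ : DSU2 →⋆ₐ[ℂ] (H →L[ℂ] H)) (x : SU2) (f : C(SU2, ℂ)) :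
    ρ (DSU2.tens x f) = funRep ρ (adPull x⁻¹ f) * groupAct ρ x := by
  rw [DSU2.tens_eq_mul', map_mul]; rfl

lemma groupAct_funRep_apply (ρ : DSU2 →⋆ₐ[ℂ] (H →L[ℂ] H)) {ω : H} (hω : ω ∈ invVectors ρ)
    (x : SU2) (f : C(SU2, ℂ)) :
    groupAct ρ x (funRep ρ f ω) = funRep ρ (adPull x⁻¹ f) ω := by
  rw [← mul_apply_eq_comp, ← rho_tens, rho_tens', mul_apply_eq_comp, hω x]

/-- The cyclic subspace generated by a non-zero vector of an irreducible representation. -/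
lemma IsIrreducibleRep.denseRange {ρ : DSU2 →⋆ₐ[ℂ] (H →L[ℂ] H)} (hρ : IsIrreducibleRep ρ) {ω : H}
    (hω : ω ≠ 0) : DenseRange fun X => ρ X ω := by
  let T : DSU2 →ₗ[ℂ] H :=
    { toFun := fun X => ρ X ω, map_add' := by simp, map_smul' := by simp }
  have hinv : ∀ X, ∀ v ∈ T.range.topologicalClosure, ρ X v ∈ T.range.topologicalClosure := by
    intro X v hv
    refine map_mem_closure (ρ X).continuous hv ?_
    rintro _ ⟨Y, rfl⟩
    exact ⟨X * Y, by simp [T]⟩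
  rcases hρ.2 _ (Submodule.isClosed_topologicalClosure _) hinv with h | h
  · refine absurd ?_ hω
    rw [← Submodule.mem_bot ℂ, ← h]
    exact Submodule.le_topologicalClosure _ ⟨1, by simp [T]⟩
  · exact Submodule.dense_iff_topologicalClosure_eq_top.mpr h

/-- In `x ⊗ f` the group element can be moved to the right at the cost of conjugating `f`, and there
it fixes `ω`. So the functions alone generate the whole cyclic subspace. -/
lemma IsIrreducibleRep.denseRange_funRep {ρ : DSU2 →⋆ₐ[ℂ] (H →L[ℂ] H)} (hρ : IsIrreducibleRep ρ)
    {ω : H} (hω : ω ≠ 0) (hinv : ω ∈ invVectors ρ) : DenseRange fun f => funRep ρ f ω := by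
  refine (hρ.denseRange hω).mono ?_
  rintro _ ⟨X, rfl⟩
  change ρ X ω ∈ _
  induction X using DSU2.induction with
  | h0 => exact ⟨0, by simp⟩
  | hadd X Y hX hY =>
    obtain ⟨f, hf⟩ := hX
    obtain ⟨g, hg⟩ := hY
    exact ⟨f + g, by simp only at hf hg ⊢; rw [map_add, map_add, add_apply, add_apply, hf, hg]⟩
  | ht x f => exact ⟨adPull x⁻¹ f, by rw [rho_tens', mul_apply_eq_comp, hinv x]⟩

/-- Uniqueness of the GNS construction. -/
lemma unitarilyEquivalent_of_inner {ρ : DSU2 →⋆ₐ[ℂ] (H →L[ℂ] H)} {ρ' : DSU2 →⋆ₐ[ℂ] (H' →L[ℂ] H')}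
    {ω : H} {ω' : H'} (h : DenseRange fun X => ρ X ω) (h' : DenseRange fun X => ρ' X ω')
    (hK : ∀ X, ⟪ω, ρ X ω⟫_ℂ = ⟪ω', ρ' X ω'⟫_ℂ) : UnitarilyEquivalent ρ ρ' := by
  let T : DSU2 →ₗ[ℂ] H :=
    { toFun := fun X => ρ X ω, map_add' := by simp, map_smul' := by simp }
  let T' : DSU2 →ₗ[ℂ] H' :=
    { toFun := fun X => ρ' X ω', map_add' := by simp, map_smul' := by simp }
  have hn : ∀ X, ‖T' (LinearEquiv.refl ℂ DSU2 X)‖ = ‖T X‖ := fun X => by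
    rw [← sq_eq_sq₀ (norm_nonneg _) (norm_nonneg _)]
    have h1 : ∀ (v : H), ((‖v‖ ^ 2 : ℝ) : ℂ) = ⟪v, v⟫_ℂ := fun v => by
      rw [inner_self_eq_norm_sq_to_K]; simp
    have h2 : ∀ (v : H'), ((‖v‖ ^ 2 : ℝ) : ℂ) = ⟪v, v⟫_ℂ := fun v => by
      rw [inner_self_eq_norm_sq_to_K]; simp
    -- Evaluating the states on `X* X` compares the norms of `ρ X ω` and `ρ' X ω'`.
    have h3 := hK (star X * X)
    rw [map_mul, mul_apply_eq_comp, inner_apply, star_star, map_mul, mul_apply_eq_comp,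
      inner_apply ρ', star_star, ← h1, ← h2] at h3
    exact (Complex.ofReal_injective h3).symm
  let U := (LinearEquiv.refl ℂ DSU2).extendOfIsometry T T' h h' hn
  have hU : ∀ X, U (T X) = T' X := fun X =>
    LinearEquiv.extendOfIsometry_eq (LinearEquiv.refl ℂ DSU2) T T' h h' hn X
  refine ⟨U, fun X v => ?_⟩
  refine congrFun (DenseRange.equalizer (f := T) h (g := fun v => U (ρ X v))
    (h := fun v => ρ' X (U v)) (U.continuous.comp (ρ X).continuous) ((ρ' X).continuous.comp U.continuous) ?_) v
  ext Y
  change U (ρ X (T Y)) = ρ' X (U (T Y))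
  have h4 : ρ X (T Y) = T (X * Y) := by simp [T]
  rw [h4, hU, hU]
  simp [T']

/-- Invariant linear forms correspond to invariant vectors. -/
lemma mem_invForms_iff (ρ : DSU2 →⋆ₐ[ℂ] (H →L[ℂ] H)) (φ : H →L[ℂ] ℂ) :
    φ ∈ invForms ρ ↔ ∃ v ∈ invVectors ρ, φ = innerSL ℂ v := by
  constructor
  · intro h
    refine ⟨(InnerProductSpace.toDual ℂ H).symm φ, fun x => ?_, ?_⟩
    · refine ext_inner_right ℂ fun w => ?_
      have h1 := inner_groupAct ρ x⁻¹ ((InnerProductSpace.toDual ℂ H).symm φ) w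
      rw [inv_inv] at h1
      rw [← h1, InnerProductSpace.toDual_symm_apply, InnerProductSpace.toDual_symm_apply]
      exact h x⁻¹ w
    · ext w
      rw [innerSL_apply_apply, InnerProductSpace.toDual_symm_apply]
  · rintro ⟨v, hv, rfl⟩ x w
    rw [innerSL_apply_apply, innerSL_apply_apply, inner_groupAct, hv]

/-- If the invariant vectors are the multiples of a unit vector `ω`, the invariant forms are the
multiples of `⟨ω|`. -/
lemma invForms_eq_of_invVectors {ρ : DSU2 →⋆ₐ[ℂ] (H →L[ℂ] H)} {ω : H}
    (h : ∀ v, v ∈ invVectors ρ ↔ ∃ c : ℂ, v = c • ω) (φ : H →L[ℂ] ℂ) :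
    φ ∈ invForms ρ ↔ ∃ c : ℂ, φ = c • innerSL ℂ ω := by
  rw [mem_invForms_iff]
  constructor
  · rintro ⟨v, hv, rfl⟩
    obtain ⟨c, rfl⟩ := (h v).mp hv
    exact ⟨starRingEnd ℂ c, by rw [map_smulₛₗ]⟩
  · rintro ⟨c, rfl⟩
    exact ⟨starRingEnd ℂ c • ω, (h _).mpr ⟨_, rfl⟩, by rw [map_smulₛₗ]; simp⟩

lemma finrank_eq_one_of_forall {M : Type*} [AddCommGroup M] [Module ℂ M] {p : Submodule ℂ M} {e : M}
    (he : e ≠ 0) (h : ∀ v, v ∈ p ↔ ∃ c : ℂ, v = c • e) : Module.finrank ℂ p = 1 := by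
  refine finrank_eq_one (⟨e, (h e).mpr ⟨1, (one_smul _ _).symm⟩⟩ : p)
    (fun h0 => he (congrArg Subtype.val h0)) fun w => ?_
  obtain ⟨c, hc⟩ := (h w).mp w.2
  exact ⟨c, Subtype.ext hc.symm⟩

/-! ### Decomposition into irreducible representations of SU(2) -/

/-- The functions which generate a finite-dimensional representation under conjugation. -/
def adFinite : StarSubalgebra ℂ C(SU2, ℂ) where
  carrier := {f | ∃ M : Submodule ℂ C(SU2, ℂ), M.FG ∧ f ∈ M ∧ ∀ y, ∀ k ∈ M, adPull y k ∈ M}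
  add_mem' := by
    rintro f g ⟨M, h1, h2, h3⟩ ⟨N, k1, k2, k3⟩
    refine ⟨M ⊔ N, h1.sup k1, Submodule.add_mem_sup h2 k2, fun y k hk => ?_⟩
    obtain ⟨a, ha, b, hb, rfl⟩ := Submodule.mem_sup.mp hk
    rw [map_add]
    exact Submodule.add_mem_sup (h3 y a ha) (k3 y b hb)
  mul_mem' := by
    rintro f g ⟨M, h1, h2, h3⟩ ⟨N, k1, k2, k3⟩
    refine ⟨M * N, h1.mul k1, Submodule.mul_mem_mul h2 k2, fun y k hk => ?_⟩
    induction hk using Submodule.mul_induction_on' with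
    | mem_mul_mem a ha b hb =>
      rw [map_mul]; exact Submodule.mul_mem_mul (h3 y a ha) (k3 y b hb)
    | add a _ b _ ha hb => rw [map_add]; exact Submodule.add_mem _ ha hb
  algebraMap_mem' c := by
    refine ⟨Submodule.span ℂ {1}, Submodule.fg_span_singleton _, ?_, fun y k hk => ?_⟩
    · rw [Algebra.algebraMap_eq_smul_one]
      exact Submodule.smul_mem _ _ (Submodule.mem_span_singleton_self 1)
    · obtain ⟨a, rfl⟩ := Submodule.mem_span_singleton.mp hk
      rwa [map_smul, map_one]
  star_mem' := by
    rintro f ⟨M, h1, h2, h3⟩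
    refine ⟨M.map (starLinearEquiv ℂ (A := C(SU2, ℂ))).toLinearMap, h1.map _, ⟨f, h2, rfl⟩, ?_⟩
    rintro y _ ⟨k, hk, rfl⟩
    exact ⟨adPull y k, h3 y k hk, (map_star (adPull y) k).symm⟩

/-- A matrix entry, as a continuous function on `SU(2)`. -/
def entry (i j : Fin 2) : C(SU2, ℂ) := ⟨fun g => g.1 i j, continuous_subtype_val.matrix_elem i j⟩

lemma entry_mem_adFinite (i j : Fin 2) : entry i j ∈ adFinite := by
  refine ⟨Submodule.span ℂ (Set.range fun p : Fin 2 × Fin 2 => entry p.1 p.2),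
    Submodule.fg_span (Set.finite_range _), Submodule.subset_span ⟨(i, j), rfl⟩, fun y k hk => ?_⟩
  induction hk using Submodule.span_induction with
  | mem k hk =>
    obtain ⟨⟨a, b⟩, rfl⟩ := hk
    have h : adPull y (entry a b) = ∑ c, ∑ d, (y.1 a c * (y⁻¹).1 d b) • entry c d := by
      ext g
      change (y * g * y⁻¹ : SU2).1 a b = _
      rw [Submonoid.coe_mul, Submonoid.coe_mul]
      simp only [Matrix.mul_apply, Fin.sum_univ_two, ContinuousMap.add_apply,
        ContinuousMap.smul_apply, smul_eq_mul, entry, ContinuousMap.coe_mk]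
      ring
    rw [h]
    exact Submodule.sum_mem _ fun c _ => Submodule.sum_mem _ fun d _ =>
      Submodule.smul_mem _ _ (Submodule.subset_span ⟨(c, d), rfl⟩)
  | zero => simp
  | add a b _ _ ha hb => rw [map_add]; exact Submodule.add_mem _ ha hb
  | smul c a _ ha => rw [map_smul]; exact Submodule.smul_mem _ _ ha

/-- Stone–Weierstrass: the matrix entries lie in this star subalgebra and separate points. -/
lemma dense_adFinite : Dense (adFinite : Set C(SU2, ℂ)) := by
  have h := ContinuousMap.starSubalgebra_topologicalClosure_eq_top_of_separatesPoints adFinite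
    (by
      intro x y hxy
      by_contra hcon
      push Not at hcon
      exact hxy (Subtype.ext (Matrix.ext fun i j =>
        hcon _ ⟨entry i j, entry_mem_adFinite i j, rfl⟩)))
  intro f
  have h1 : f ∈ adFinite.topologicalClosure := h ▸ StarSubalgebra.mem_top
  exact h1

/-- A non-zero finite-dimensional invariant subspace with continuous action contains an irreducible
one. -/
lemma exists_isGroupIrrep_le (ρ : DSU2 →⋆ₐ[ℂ] (H →L[ℂ] H)) (E : Submodule ℂ H)
    (hfin : FiniteDimensional ℂ E) (hE : E ≠ ⊥) (hinv : ∀ x, ∀ v ∈ E, groupAct ρ x v ∈ E)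
    (hcont : ∀ v ∈ E, Continuous fun x => groupAct ρ x v) : ∃ W ≤ E, IsGroupIrrep ρ W := by
  classical
  let P : ℕ → Prop := fun n => ∃ W ≤ E, W ≠ ⊥ ∧ (∀ x, ∀ v ∈ W, groupAct ρ x v ∈ W) ∧
    Module.finrank ℂ W = n
  have hP : ∃ n, P n := ⟨_, E, le_rfl, hE, hinv, rfl⟩
  -- A nonzero invariant subspace of least dimension is irreducible.
  obtain ⟨W, hWE, hW0, hWinv, hWn⟩ := Nat.find_spec hP
  have hWfin : FiniteDimensional ℂ W := Submodule.finiteDimensional_of_le hWE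
  refine ⟨W, hWE, hWfin, hWinv, fun v hv => hcont v (hWE hv), hW0, fun W' hW' hinv' => ?_⟩
  by_contra! hcon
  have hlt : Module.finrank ℂ W' < Module.finrank ℂ W :=
    Submodule.finrank_lt_finrank_of_lt (lt_of_le_of_ne hW' hcon.2)
  rw [hWn] at hlt
  exact Nat.find_min hP hlt ⟨W', hW'.trans hWE, hcon.1, hinv', rfl⟩

/-- The orthogonal projection onto an invariant subspace commutes with the group. -/
lemma starProjection_groupAct (ρ : DSU2 →⋆ₐ[ℂ] (H →L[ℂ] H)) (W : Submodule ℂ H)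
    [W.HasOrthogonalProjection] (hW : ∀ x, ∀ v ∈ W, groupAct ρ x v ∈ W) (x : SU2) (v : H) :
    W.starProjection (groupAct ρ x v) = groupAct ρ x (W.starProjection v) := by
  refine Submodule.eq_starProjection_of_mem_of_inner_eq_zero
    (hW x _ (Submodule.starProjection_apply_mem _ _)) fun w hw => ?_
  rw [← map_sub]
  have h1 := inner_groupAct ρ x⁻¹ (v - W.starProjection v) w
  rw [inv_inv] at h1
  rw [← h1]
  exact Submodule.starProjection_inner_eq_zero _ _ (hW _ _ hw)

/-- A maximal orthogonal family of irreducibles must have dense span. Since `ω` is invariant, a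
conjugation-finite `f` gives a vector `f ω` in a finite-dimensional invariant subspace, and such
vectors are dense. If the orthogonal complement of the family were nonzero, projecting one of them
there would produce a further irreducible. -/
lemma IsIrreducibleRep.exists_decomposition {ρ : DSU2 →⋆ₐ[ℂ] (H →L[ℂ] H)}
    (hρ : IsIrreducibleRep ρ) {ω : H} (hω : ω ≠ 0) (hinv : ω ∈ invVectors ρ) :
    ∃ S : Set (Submodule ℂ H), (∀ E ∈ S, IsGroupIrrep ρ E) ∧
      S.Pairwise (fun E E' => E ⟂ E') ∧ (sSup S).topologicalClosure = ⊤ := by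
  obtain ⟨S, hS⟩ := zorn_subset {S : Set (Submodule ℂ H) | (∀ E ∈ S, IsGroupIrrep ρ E) ∧
      S.Pairwise (fun E E' => E ⟂ E')} (by
    intro c hc hchain
    refine ⟨⋃₀ c, ⟨?_, ?_⟩, fun s hs => Set.subset_sUnion_of_mem hs⟩
    · rintro E ⟨s, hs, hE⟩
      exact (hc hs).1 E hE
    · exact (Set.pairwise_sUnion hchain.directedOn).mpr fun s hs => (hc hs).2)
  refine ⟨S, hS.prop.1, hS.prop.2, ?_⟩
  by_contra hne
  set U := (sSup S)ᗮ with hU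
  have hU0 : U ≠ ⊥ := fun h => hne ((Submodule.topologicalClosure_eq_top_iff).mpr h)
  have hSinv : ∀ x, ∀ v ∈ sSup S, groupAct ρ x v ∈ sSup S := by
    intro x v hv
    have h1 : sSup S ≤ (sSup S).comap (groupAct ρ x).toLinearMap :=
      sSup_le fun E hE v hv => (le_sSup hE : E ≤ sSup S) ((hS.prop.1 E hE).invariant x v hv)
    exact h1 hv
  have hUinv : ∀ x, ∀ v ∈ U, groupAct ρ x v ∈ U := by
    intro x v hv w hw
    rw [inner_groupAct]
    exact hv _ (hSinv _ _ hw)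
  have hdense : DenseRange fun f : (adFinite : Set C(SU2, ℂ)) => funRep ρ f.1 ω :=
    (hρ.denseRange_funRep hω hinv).comp dense_adFinite.denseRange_val
      ((continuous_funRep ρ).clm_apply continuous_const)
  -- Otherwise the projection onto `U` would vanish on a dense set, hence everywhere.
  have hex : ∃ f ∈ adFinite, U.starProjection (funRep ρ f ω) ≠ 0 := by
    by_contra! hcon
    have h0 : (fun v => U.starProjection v) = fun _ => 0 :=
      hdense.equalizer U.starProjection.continuous continuous_const
        (funext fun f => hcon f.1 f.2)
    refine hU0 ((Submodule.eq_bot_iff _).mpr fun v hv => ?_)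
    rw [← Submodule.starProjection_eq_self_iff.mpr hv]
    exact congrFun h0 v
  obtain ⟨f, ⟨M, hM, hfM, hMinv⟩, hf⟩ := hex
  let T : C(SU2, ℂ) →ₗ[ℂ] H :=
    { toFun := fun f => U.starProjection (funRep ρ f ω)
      map_add' := by simp
      map_smul' := by simp }
  have hT : ∀ x k, groupAct ρ x (T k) = T (adPull x⁻¹ k) := fun x k => by
    change groupAct ρ x (U.starProjection _) = U.starProjection _
    rw [← starProjection_groupAct ρ U hUinv, groupAct_funRep_apply ρ hinv]
  obtain ⟨W, hWE, hW⟩ := exists_isGroupIrrep_le ρ (M.map T)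
    (Module.Finite.iff_fg.mpr (hM.map T))
    (fun h => hf ((Submodule.mem_bot ℂ).mp (h ▸ Submodule.mem_map_of_mem (f := T) hfM)))
    (by
      rintro x _ ⟨k, hk, rfl⟩
      rw [hT]
      exact Submodule.mem_map_of_mem (hMinv _ k hk))
    (by
      rintro _ ⟨k, hk, rfl⟩
      simp only [hT]
      exact U.starProjection.continuous.comp (((continuous_funRep ρ).comp
        ((continuous_adPull k).comp continuous_inv)).clm_apply continuous_const))
  have hWU : W ≤ U := hWE.trans (by
    rintro _ ⟨k, -, rfl⟩
    exact Submodule.starProjection_apply_mem _ _)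
  have hmem : insert W S ∈ {S : Set (Submodule ℂ H) | (∀ E ∈ S, IsGroupIrrep ρ E) ∧
      S.Pairwise (fun E E' => E ⟂ E')} := by
    refine ⟨fun E hE => ?_, Set.pairwise_insert.mpr
      ⟨hS.prop.2, fun E hE _ => ?_⟩⟩
    · rcases hE with rfl | hE
      · exact hW
      · exact hS.prop.1 E hE
    · have h1 : W ⟂ E := hWU.trans (Submodule.orthogonal_le (le_sSup hE))
      exact ⟨h1, h1.symm⟩
  have hWS : W ∈ S := hS.le_of_ge hmem (Set.subset_insert W S) (Set.mem_insert W S)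
  -- By maximality `W` belongs to `S`, yet it lies in the orthogonal complement of the span of `S`.
  refine hW.ne_bot ((Submodule.eq_bot_iff _).mpr fun v hv => ?_)
  exact inner_self_eq_zero.mp (hWU hv v ((le_sSup hWS : W ≤ sSup S) hv))

/-- A criterion of simplicity. -/
lemma isSimple_of_invVectors {ρ : DSU2 →⋆ₐ[ℂ] (H →L[ℂ] H)} (hρ : IsIrreducibleRep ρ) {ω : H}
    (hω : ‖ω‖ = 1) (h : ∀ v, v ∈ invVectors ρ ↔ ∃ c : ℂ, v = c • ω) : IsSimple ρ := by
  have hω0 : ω ≠ 0 := fun h0 => by simp [h0] at hω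
  have hωinv : ω ∈ invVectors ρ := (h ω).mpr ⟨1, (one_smul _ _).symm⟩
  have hform := invForms_eq_of_invVectors h
  refine ⟨hρ, hρ.exists_decomposition hω0 hωinv, finrank_eq_one_of_forall hω0 h,
    finrank_eq_one_of_forall (fun h0 => ?_) hform, innerSL ℂ ω,
    (hform _).mpr ⟨1, (one_smul _ _).symm⟩, ω, hωinv, ?_⟩
  · have := innerSL_self_of_norm_one hω
    rw [h0] at this
    simp at this
  · rw [innerSL_self_of_norm_one hω]; exact one_ne_zero

lemma IsSimple.exists_unit_invVector {ρ : DSU2 →⋆ₐ[ℂ] (H →L[ℂ] H)} (hρ : IsSimple ρ) :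
    ∃ ω ∈ invVectors ρ, ‖ω‖ = 1 := by
  obtain ⟨-, -, -, -, φ, -, v, hv, hv0⟩ := hρ
  have hv1 : v ≠ 0 := fun h => hv0 (by rw [h, map_zero])
  refine ⟨((‖v‖ : ℂ)⁻¹) • v, Submodule.smul_mem _ _ hv, norm_smul_inv_norm hv1⟩

end

/-! ### The representations (θ, s) -/

/-- A left invariant square integrable function is constant. -/
lemma ae_const_of_leftT {ψ : L2} (h : ∀ x, leftT x ψ = ψ) : ∃ c : ℂ, ψ =ᵐ[haar] fun _ => c := by
  have hm : Measurable (ψ : SU2 → ℂ) := (Lp.stronglyMeasurable ψ).measurable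
  have h1 : ∀ᵐ x ∂haar, ∀ᵐ a ∂haar, ψ (x⁻¹ * a) = ψ a := ae_of_all _ fun x => by
    have := leftT_apply x ψ
    rw [h x] at this
    filter_upwards [this] with a ha using ha.symm
  -- Exchanging the quantifiers yields one base point `a` with `ψ (x⁻¹ a) = ψ a` for almost every
  -- `x`; the substitution `x = a y⁻¹` then reads `ψ y = ψ a`.
  rw [Measure.ae_ae_comm (p := fun x a => ψ (x⁻¹ * a) = ψ a) (measurableSet_eq_fun
    (hm.comp (measurable_fst.inv.mul measurable_snd)) (hm.comp measurable_snd))] at h1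
  obtain ⟨a, ha⟩ := h1.exists
  refine ⟨ψ a, ?_⟩
  filter_upwards [(quasiMeasurePreserving_div_left haar a).ae ha] with y hy
  rw [← hy]
  simp

lemma toLp_one_apply : (ContinuousMap.toLp 2 haar ℂ (1 : C(SU2, ℂ)) : L2) =ᵐ[haar] fun _ => 1 :=
  ContinuousMap.coeFn_toLp (p := 2) (𝕜 := ℂ) haar (1 : C(SU2, ℂ))

lemma eq_smul_one {ψ : L2} {c : ℂ} (h : ψ =ᵐ[haar] fun _ => c) :
    ψ = c • (ContinuousMap.toLp 2 haar ℂ (1 : C(SU2, ℂ)) : L2) := by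
  refine Lp.ext ?_
  filter_upwards [h, toLp_one_apply,
    Lp.coeFn_smul c (ContinuousMap.toLp 2 haar ℂ (1 : C(SU2, ℂ)) : L2)] with a h1 h2 h3
  rw [h1, h3, Pi.smul_apply, h2, smul_eq_mul, mul_one]

lemma orbitRep_tens_one (h x : SU2) (ψ : L2) : orbitRep h (DSU2.tens x 1) ψ = leftT x ψ := by
  rw [orbitRep, covariantRep_tens, map_one, mul_one]; rfl

lemma orbitRep_one_tens (h : SU2) (f : C(SU2, ℂ)) (ψ : L2) :
    orbitRep h (DSU2.tens 1 f) ψ = mulOp (orbitPull h f) ψ := by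
  rw [orbitRep, covariantRep_tens, map_one, OneMemClass.coe_one, one_mul]; rfl

lemma coe_groupAct_rep (θ : ℝ) (s : ℤ) (x : SU2) (v : vSpace θ s) :
    (groupAct (rep θ s) x v : L2) = leftT x v := by
  rw [groupAct, rep, restrictRep_apply, orbitRep_tens_one]

lemma coe_funRep_rep (θ : ℝ) (s : ℤ) (f : C(SU2, ℂ)) (v : vSpace θ s) :
    (funRep (rep θ s) f v : L2) = mulOp (orbitPull (hTheta θ) f) v := by
  rw [funRep_apply, rep, restrictRep_apply, orbitRep_one_tens]

lemma leftT_one_fun (x : SU2) :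
    leftT x (ContinuousMap.toLp 2 haar ℂ (1 : C(SU2, ℂ))) = ContinuousMap.toLp 2 haar ℂ 1 := by
  refine Lp.ext ?_
  filter_upwards [leftT_apply x (ContinuousMap.toLp 2 haar ℂ (1 : C(SU2, ℂ))), toLp_one_apply,
    ae_left x⁻¹ toLp_one_apply] with a h1 h2 h3
  rw [h1, h2, h3]

lemma norm_omegaOne (θ : ℝ) : ‖omegaOne θ‖ = 1 := by
  have h1 : ⟪(ContinuousMap.toLp 2 haar ℂ (1 : C(SU2, ℂ)) : L2),
      ContinuousMap.toLp 2 haar ℂ (1 : C(SU2, ℂ))⟫_ℂ = 1 := by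
    rw [L2.inner_def]
    have : (fun a => ⟪(ContinuousMap.toLp 2 haar ℂ (1 : C(SU2, ℂ)) : L2) a,
        (ContinuousMap.toLp 2 haar ℂ (1 : C(SU2, ℂ)) : L2) a⟫_ℂ) =ᵐ[haar] fun _ => (1 : ℂ) := by
      filter_upwards [toLp_one_apply] with a h
      rw [h]; simp
    rw [integral_congr_ae this]
    simp
  rw [inner_self_eq_norm_sq_to_K] at h1
  have h2 : ‖(ContinuousMap.toLp 2 haar ℂ (1 : C(SU2, ℂ)) : L2)‖ ^ 2 = 1 :=
    Complex.ofReal_injective (by simpa using h1)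
  exact (pow_eq_one_iff_of_nonneg (norm_nonneg _) two_ne_zero).mp h2

lemma mem_invVectors_rep_iff (θ : ℝ) (v : vSpace θ 0) :
    v ∈ invVectors (rep θ 0) ↔ ∃ c : ℂ, v = c • omegaOne θ := by
  constructor
  · intro h
    obtain ⟨c, hc⟩ := ae_const_of_leftT (ψ := v) fun x => by
      rw [← coe_groupAct_rep, h x]
    exact ⟨c, Subtype.ext (eq_smul_one hc)⟩
  · rintro ⟨c, rfl⟩
    refine Submodule.smul_mem _ _ fun x => Subtype.ext ?_
    rw [coe_groupAct_rep]
    exact leftT_one_fun x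

/-- An invariant vector is a constant `c`. The torus element of angle `π / s` lies in the
centralizer and acts on the right by `e^{iπ} = -1`, so `c = -c`. -/
lemma invVectors_rep_eq_bot (θ : ℝ) {s : ℤ} (hs : s ≠ 0) : invVectors (rep θ s) = ⊥ := by
  refine (Submodule.eq_bot_iff _).mpr fun v hv => ?_
  obtain ⟨c, hc⟩ := ae_const_of_leftT (ψ := v) fun x => by
    rw [← coe_groupAct_rep, hv x]
  have h1 := v.2 _ (hTheta_mem_centralizer θ (Real.pi / s))
  have hs' : (s : ℂ) ≠ 0 := by exact_mod_cast hs
  rw [hTheta_zero_zero, ← Complex.exp_int_mul] at h1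
  have h2 : (s : ℂ) * (((Real.pi / s : ℝ) : ℂ) * Complex.I) = Real.pi * Complex.I := by
    push_cast; field_simp
  rw [h2, Complex.exp_pi_mul_I] at h1
  have h3 : ∀ᵐ a ∂haar, c = -c := by
    filter_upwards [rightT_apply (hTheta (Real.pi / s)) v, hc, ae_right (hTheta (Real.pi / s)) hc,
      Lp.coeFn_smul (-1 : ℂ) (v : L2)] with a k1 k2 k3 k4
    rw [h1, k3, k4, Pi.smul_apply, k2] at k1
    simpa using k1.symm
  obtain ⟨-, h4⟩ := h3.exists
  have h5 : c = 0 := self_eq_neg.mp h4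
  refine Subtype.ext ?_
  rw [eq_smul_one hc, h5, zero_smul]
  rfl

/-! ### Functions on the homogeneous space -/

/-- The indicator of a closed set is a pointwise limit of continuous functions with values in `[0,
1]`. By dominated convergence `u` has zero integral over every closed set, which suffices. -/
lemma ae_eq_zero_of_integral_mul_eq_zero {u : SU2 → ℂ} (hu : Integrable u haar)
    (h : ∀ k : C(SU2, ℂ), ∫ a, u a * k a ∂haar = 0) : u =ᵐ[haar] 0 := by
  refine ae_eq_zero_of_forall_setIntegral_isClosed_eq_zero hu fun s hs => ?_
  rw [← integral_indicator hs.measurableSet]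
  have hlim : Filter.Tendsto (fun n => ∫ a, u a * ((hs.apprSeq n a : ℝ) : ℂ) ∂haar) Filter.atTop
      (nhds (∫ a, s.indicator u a ∂haar)) := by
    refine tendsto_integral_of_dominated_convergence (fun a => ‖u a‖) (fun n => ?_) hu.norm
      (fun n => ae_of_all _ fun a => ?_) (ae_of_all _ fun a => ?_)
    · exact hu.aestronglyMeasurable.mul (Continuous.aestronglyMeasurable
        (Complex.continuous_ofReal.comp (NNReal.continuous_coe.comp (hs.apprSeq n).continuous)))
    · rw [norm_mul, Complex.norm_real, Real.norm_eq_abs, NNReal.abs_eq]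
      exact mul_le_of_le_one_right (norm_nonneg _)
        (by exact_mod_cast HasOuterApproxClosed.apprSeq_apply_le_one hs n a)
    · have h1 := (tendsto_pi_nhds.mp (HasOuterApproxClosed.tendsto_apprSeq hs)) a
      have h2 : Filter.Tendsto (fun n => u a * ((hs.apprSeq n a : ℝ) : ℂ)) Filter.atTop
          (nhds (u a * (((s.indicator (fun _ => (1 : NNReal)) a : NNReal) : ℝ) : ℂ))) :=
        Filter.Tendsto.const_mul _
          (((Complex.continuous_ofReal.comp NNReal.continuous_coe).tendsto _).comp h1)
      convert h2 using 2
      by_cases ha : a ∈ s <;> simp [ha]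
  refine tendsto_nhds_unique hlim ?_
  have h0 : ∀ n, ∫ a, u a * ((hs.apprSeq n a : ℝ) : ℂ) ∂haar = 0 := fun n =>
    h ⟨fun a => ((hs.apprSeq n a : ℝ) : ℂ),
      Complex.continuous_ofReal.comp (NNReal.continuous_coe.comp (hs.apprSeq n).continuous)⟩
  simp only [h0]
  exact tendsto_const_nhds

lemma isClosed_centralizer (h : SU2) : IsClosed (Subgroup.centralizer {h} : Set SU2) := by
  have : (Subgroup.centralizer {h} : Set SU2) = {n | n * h = h * n} := by
    ext n; exact Subgroup.mem_centralizer_singleton_iff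
  rw [this]
  exact isClosed_eq (continuous_id.mul continuous_const) (continuous_const.mul continuous_id)

instance (h : SU2) : CompactSpace (Subgroup.centralizer {h}) :=
  isCompact_iff_compactSpace.mp (isClosed_centralizer h).isCompact

/-- The normalised Haar measure of a centralizer. -/
noncomputable def centHaar (h : SU2) : Measure (Subgroup.centralizer {h}) :=
  Measure.haarMeasure (⊤ : TopologicalSpace.PositiveCompacts (Subgroup.centralizer {h}))

instance (h : SU2) : (centHaar h).IsHaarMeasure := by unfold centHaar; infer_instance

instance (h : SU2) : IsProbabilityMeasure (centHaar h) :=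
  ⟨by
    simpa [centHaar] using Measure.haarMeasure_self
      (K₀ := (⊤ : TopologicalSpace.PositiveCompacts (Subgroup.centralizer {h})))⟩

/-- The average of a function over the right action of a centralizer. -/
noncomputable def average (h : SU2) (k : C(SU2, ℂ)) : C(SU2, ℂ) :=
  ⟨fun a => ∫ n : Subgroup.centralizer {h}, k (a * n) ∂(centHaar h), by
    have hc : Continuous (Function.uncurry fun (a : SU2) (n : Subgroup.centralizer {h}) =>
        k (a * n)) := k.continuous.comp (continuous_fst.mul
          (continuous_subtype_val.comp continuous_snd))
    have := continuous_parametric_integral_of_continuous (μ := centHaar h) hc isCompact_univ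
    simpa using this⟩

lemma average_apply (h : SU2) (k : C(SU2, ℂ)) (a : SU2) :
    average h k a = ∫ n : Subgroup.centralizer {h}, k (a * n) ∂(centHaar h) := rfl

/-- A function averaged over the centralizer of `h` is a function of `a h a⁻¹`. -/
lemma exists_orbitPull_eq_average (h : SU2) (k : C(SU2, ℂ)) :
    ∃ f, orbitPull h f = average h k := by
  let q : C(SU2, SU2) :=
    ⟨fun a => a * h * a⁻¹, (continuous_id.mul continuous_const).mul continuous_inv⟩
  let q' : C(SU2, Set.range q) := ⟨Set.rangeFactorization q, by fun_prop⟩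
  -- Compactness makes the orbit map closed, hence a quotient map onto the conjugacy class.
  -- Continuous functions constant on its fibres therefore descend.
  have hq' : Topology.IsQuotientMap q' :=
    q'.continuous.isClosedMap.isQuotientMap q'.continuous Set.rangeFactorization_surjective
  have hfac : Function.FactorsThrough (average h k) q' := by
    intro a b hab
    have hab' : a * h * a⁻¹ = b * h * b⁻¹ := congrArg Subtype.val hab
    have hm : b⁻¹ * a ∈ Subgroup.centralizer {h} := by
      rw [Subgroup.mem_centralizer_singleton_iff]
      calc b⁻¹ * a * h = b⁻¹ * (a * h * a⁻¹) * a := by group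
        _ = h * (b⁻¹ * a) := by rw [hab']; group
    rw [average_apply, average_apply,
      ← integral_mul_left_eq_self (fun n : Subgroup.centralizer {h} => k (b * n)) ⟨_, hm⟩]
    refine integral_congr_ae (ae_of_all _ fun n => ?_)
    change k (a * n) = k (b * (b⁻¹ * a * n))
    congr 1
    group
  -- Tietze extension from the closed conjugacy class to the whole group.
  obtain ⟨f, hf⟩ := ContinuousMap.exists_restrict_eq (isCompact_range q.continuous).isClosed
    (hq'.lift (average h k) hfac)
  refine ⟨f, ?_⟩
  ext a
  have h1 := DFunLike.congr_fun hf (q' a)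
  have h2 := DFunLike.congr_fun (hq'.lift_comp (average h k) hfac) a
  exact h1.trans h2

lemma ContinuousMap.integrable_haar (k : C(SU2, ℂ)) {m : Measure SU2} [IsFiniteMeasure m] :
    Integrable k m :=
  k.continuous.integrable_of_hasCompactSupport (HasCompactSupport.of_compactSpace k)

/-- Fubini, then the right translation by `n` is absorbed by Haar measure because `u` itself is
invariant under it. -/
lemma integral_mul_average (h : SU2) {u : SU2 → ℂ} (hu : Integrable u haar)
    (hinv : ∀ n ∈ Subgroup.centralizer {h}, ∀ᵐ a ∂haar, u (a * n) = u a) (k : C(SU2, ℂ)) :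
    ∫ a, u a * average h k a ∂haar = ∫ a, u a * k a ∂haar := by
  have hint : Integrable (fun p : SU2 × Subgroup.centralizer {h} => u p.1 * k (p.1 * p.2))
      (haar.prod (centHaar h)) := by
    refine (hu.comp_fst (centHaar h)).mul_bdd (c := ‖k‖) ?_ (ae_of_all _ fun p =>
      k.norm_coe_le_norm _)
    exact (k.continuous.comp (continuous_fst.mul
      (continuous_subtype_val.comp continuous_snd))).aestronglyMeasurable
  calc ∫ a, u a * average h k a ∂haar
      = ∫ a, ∫ n : Subgroup.centralizer {h}, u a * k (a * n) ∂(centHaar h) ∂haar := by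
        simp only [average_apply, integral_const_mul]
    _ = ∫ n : Subgroup.centralizer {h}, ∫ a, u a * k (a * n) ∂haar ∂(centHaar h) :=
        integral_integral_swap hint
    _ = ∫ n : Subgroup.centralizer {h}, ∫ a, u a * k a ∂haar ∂(centHaar h) := by
        refine integral_congr_ae (ae_of_all _ fun n => ?_)
        change ∫ a, u a * k (a * n) ∂haar = ∫ a, u a * k a ∂haar
        rw [← integral_mul_right_eq_self (fun a => u a * k a) (n : SU2)]
        refine integral_congr_ae ?_
        filter_upwards [hinv n n.2] with a ha
        rw [ha]
    _ = ∫ a, u a * k a ∂haar := by simp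

/-- An invariant `u` pairs with a test function only through the average over the centralizer, and
averages are pulled back from the class. So testing against pulled-back functions is enough. -/
lemma ae_eq_zero_of_integral_orbitPull (h : SU2) {u : SU2 → ℂ} (hu : Integrable u haar)
    (hinv : ∀ n ∈ Subgroup.centralizer {h}, ∀ᵐ a ∂haar, u (a * n) = u a)
    (horth : ∀ f, ∫ a, u a * orbitPull h f a ∂haar = 0) : u =ᵐ[haar] 0 := by
  refine ae_eq_zero_of_integral_mul_eq_zero hu fun k => ?_
  obtain ⟨f, hf⟩ := exists_orbitPull_eq_average h k
  rw [← integral_mul_average h hu hinv k, ← hf, horth f]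

/-! ### Irreducibility of the representations `(θ, 0)` -/

open ComplexConjugate in
lemma ae_mul_eq_zero_of_inner (θ : ℝ) (w v : vSpace θ 0)
    (h : ∀ f, ⟪w, funRep (rep θ 0) f v⟫_ℂ = 0) :
    ∀ᵐ a ∂haar, (w : L2) a = 0 ∨ (v : L2) a = 0 := by
  have hu : Integrable (fun a => ⟪(w : L2) a, (v : L2) a⟫_ℂ) haar :=
    L2.integrable_inner (w : L2) (v : L2)
  have h1 := ae_eq_zero_of_integral_orbitPull (hTheta θ) hu (fun n hn => by
      have hw := w.2 n hn
      have hv := v.2 n hn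
      rw [zpow_zero, one_smul] at hw hv
      filter_upwards [rightT_apply n w, rightT_apply n v] with a k1 k2
      rw [hw] at k1
      rw [hv] at k2
      rw [← k1, ← k2]) (fun f => by
      rw [← h f, Submodule.coe_inner, coe_funRep_rep, L2.inner_def]
      refine integral_congr_ae ?_
      filter_upwards [mulOp_apply (orbitPull (hTheta θ) f) v] with a k
      rw [k]
      simp only [RCLike.inner_apply]
      ring)
  filter_upwards [h1] with a ha
  rw [Pi.zero_apply, RCLike.inner_apply, mul_eq_zero, map_eq_zero] at ha
  exact ha.symm

/-- By Fubini, for almost every `a` the alternative holds for almost every `x`. If `v a ≠ 0` for one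
such `a`, then `w (x a) = 0` for almost every `x`, and right invariance of Haar measure gives `w =
0`. -/
lemma eq_zero_of_ae_translates {w v : L2}
    (h : ∀ x : SU2, ∀ᵐ a ∂haar, w (x * a) = 0 ∨ v a = 0) : w = 0 ∨ v = 0 := by
  by_contra! hcon
  have hw : Measurable (w : SU2 → ℂ) := (Lp.stronglyMeasurable w).measurable
  have hv : Measurable (v : SU2 → ℂ) := (Lp.stronglyMeasurable v).measurable
  have h1 : ∀ᵐ x ∂haar, ∀ᵐ a ∂haar, w (x * a) = 0 ∨ v a = 0 := ae_of_all _ h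
  rw [Measure.ae_ae_comm (p := fun x a => w (x * a) = 0 ∨ v a = 0) ((measurableSet_eq_fun (hw.comp (measurable_fst.mul measurable_snd))
    measurable_const).union (measurableSet_eq_fun (hv.comp measurable_snd)
    measurable_const))] at h1
  refine hcon.2 ((Lp.eq_zero_iff_ae_eq_zero).mpr ?_)
  filter_upwards [h1] with a ha
  by_contra hva
  refine hcon.1 ((Lp.eq_zero_iff_ae_eq_zero).mpr ?_)
  filter_upwards [ae_right a⁻¹ ha] with y hy
  rw [inv_mul_cancel_right] at hy
  exact hy.resolve_right hva

/-- Multiplication by functions on the class forces a vector of `W` and a vector of its orthogonal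
complement to have disjoint supports. The group can translate the supports so that they meet. -/
lemma isIrreducibleRep_rep (θ : ℝ) : IsIrreducibleRep (rep θ 0) := by
  refine ⟨⟨omegaOne θ, 0, fun h => ?_⟩, fun W hW hinv => ?_⟩
  · have := norm_omegaOne θ
    rw [h, norm_zero] at this
    exact zero_ne_one this
  · by_contra! hcon
    obtain ⟨v, hv, hv0⟩ := W.ne_bot_iff.mp hcon.1
    have : CompleteSpace W := hW.completeSpace_coe
    obtain ⟨w, hw, hw0⟩ := Wᗮ.ne_bot_iff.mp
      (fun h => hcon.2 (Submodule.orthogonal_eq_bot_iff.mp h))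
    have h1 : ∀ x : SU2, ∀ᵐ a ∂haar, (w : L2) (x * a) = 0 ∨ (v : L2) a = 0 := fun x => by
      have h2 := ae_mul_eq_zero_of_inner θ (groupAct (rep θ 0) x⁻¹ w) v fun f => by
        rw [← inner_groupAct]
        exact inner_eq_zero_symm.mp (hw _ (hinv _ _ (hinv _ _ hv)))
      filter_upwards [h2, leftT_apply x⁻¹ w] with a k1 k2
      rwa [coe_groupAct_rep, k2, inv_inv] at k1
    rcases eq_zero_of_ae_translates h1 with h | h
    · exact hw0 (Subtype.ext h)
    · exact hv0 (Subtype.ext h)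

lemma isSimple_rep (θ : ℝ) : IsSimple (rep θ 0) :=
  isSimple_of_invVectors (isIrreducibleRep_rep θ) (norm_omegaOne θ) (mem_invVectors_rep_iff θ)

lemma isSimple_rep_iff (θ : ℝ) (s : ℤ) : IsSimple (rep θ s) ↔ s = 0 := by
  refine ⟨fun h => ?_, fun h => h ▸ isSimple_rep θ⟩
  by_contra hs
  have h1 := h.multiplicity_one
  rw [invVectors_rep_eq_bot θ hs, finrank_bot] at h1
  exact zero_ne_one h1

/-! ### The representations attached to central elements -/

section Central

variable {H : Type*} [NormedAddCommGroup H] [InnerProductSpace ℂ H] [CompleteSpace H]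

lemma groupAct_centralRep (h : SU2) (hc : h ∈ Subgroup.center SU2)
    (π : SU2 →* unitary (H →L[ℂ] H)) (x : SU2) : groupAct (centralRep h hc π) x = π x := by
  rw [groupAct, centralRep, covariantRep_tens, map_one, mul_one]

/-- The invariant vectors form a closed subspace stable under `π`, hence are zero or everything, and
simplicity excludes zero. Conversely, a trivial irreducible `π` is one-dimensional, since it
preserves every line. -/
lemma isSimple_centralRep_iff (h : SU2) (hc : h ∈ Subgroup.center SU2)
    (π : SU2 →* unitary (H →L[ℂ] H)) (hπ : IsIrreducibleGroupRep π) :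
    IsSimple (centralRep h hc π) ↔ ∀ x, π x = 1 := by
  constructor
  · intro hs x
    obtain ⟨ω, hω, hω1⟩ := hs.exists_unit_invVector
    have hclosed : IsClosed (invVectors (centralRep h hc π) : Set H) := by
      have : (invVectors (centralRep h hc π) : Set H) =
          ⋂ x, {v | groupAct (centralRep h hc π) x v = v} := by
        ext v; rw [Set.mem_iInter]; rfl
      rw [this]
      exact isClosed_iInter fun x => isClosed_eq (ContinuousLinearMap.continuous _) continuous_id
    rcases hπ.2 _ hclosed (fun y v hv => by
      have := hv y
      rw [groupAct_centralRep] at this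
      rwa [this]) with h0 | h0
    · rw [h0, Submodule.mem_bot] at hω
      rw [hω, norm_zero] at hω1
      exact absurd hω1 zero_ne_one
    · refine Subtype.ext (ContinuousLinearMap.ext fun v => ?_)
      have hv : v ∈ invVectors (centralRep h hc π) := h0 ▸ Submodule.mem_top
      have := hv x
      rwa [groupAct_centralRep] at this
  · intro h1
    obtain ⟨hnt, hirr⟩ := hπ
    obtain ⟨v, hv⟩ := exists_ne (0 : H)
    have hirr' : IsIrreducibleRep (centralRep h hc π) := ⟨hnt, fun W hW hinv =>
      hirr W hW fun x v hv => by rw [← groupAct_centralRep h hc]; exact hinv _ v hv⟩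
    have hn : ‖((‖v‖ : ℂ)⁻¹) • v‖ = 1 := norm_smul_inv_norm hv
    have hspan : Submodule.span ℂ {((‖v‖ : ℂ)⁻¹) • v} = ⊤ := by
      refine (hirr _ (Submodule.closed_of_finiteDimensional _) fun x w hw => ?_).resolve_left ?_
      · rw [h1 x]; exact hw
      · rw [Submodule.span_singleton_eq_bot]
        intro h2
        rw [h2, norm_zero] at hn
        exact zero_ne_one hn
    refine isSimple_of_invVectors hirr' hn fun w => ⟨fun _ => ?_, fun _ => ?_⟩
    · have hw : w ∈ Submodule.span ℂ {((‖v‖ : ℂ)⁻¹) • v} := hspan ▸ Submodule.mem_top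
      obtain ⟨c, hc⟩ := Submodule.mem_span_singleton.mp hw
      exact ⟨c, hc.symm⟩
    · intro x
      rw [groupAct_centralRep, h1 x]
      rfl

end Central

/-! ### Classification of the simple representations -/

section

variable {H : Type*} [NormedAddCommGroup H] [InnerProductSpace ℂ H] [CompleteSpace H]

/-- Functions of the trace are fixed by conjugation, so they are central in the double. -/
lemma rho_comm_traceFun (ρ : DSU2 →⋆ₐ[ℂ] (H →L[ℂ] H)) (φ : C(ℝ, ℂ)) (X : DSU2) :
    ρ X * funRep ρ (traceFun φ) = funRep ρ (traceFun φ) * ρ X := by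
  induction X using DSU2.induction with
  | h0 => simp
  | hadd X Y hX hY => rw [map_add, add_mul, mul_add, hX, hY]
  | ht x f =>
    rw [funRep_apply, ← map_mul, ← map_mul, DSU2.tens_mul_tens, DSU2.tens_mul_tens,
      adPull_traceFun, adPull_one, mul_one, one_mul, mul_comm]

/-- A form of Schur's lemma: the kernel of a central operator is closed and invariant, so such an
operator is zero or injective, and there are no zero divisors among them. -/
lemma IsIrreducibleRep.eq_zero_or_eq_zero {ρ : DSU2 →⋆ₐ[ℂ] (H →L[ℂ] H)} (hρ : IsIrreducibleRep ρ)
    {φ ψ : C(ℝ, ℂ)} (h : φ * ψ = 0) :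
    funRep ρ (traceFun φ) = 0 ∨ funRep ρ (traceFun ψ) = 0 := by
  have hprod : funRep ρ (traceFun φ) * funRep ρ (traceFun ψ) = 0 := by
    rw [← map_mul]
    have : traceFun φ * traceFun ψ = 0 := by
      ext g
      exact DFunLike.congr_fun h (halfTrace g)
    rw [this, map_zero]
  rcases hρ.2 (LinearMap.ker (funRep ρ (traceFun φ)).toLinearMap)
    (ContinuousLinearMap.isClosed_ker _) (fun X v hv => by
      have h1 := congrArg (fun T : H →L[ℂ] H => T v) (rho_comm_traceFun ρ φ X)
      have h2 : funRep ρ (traceFun φ) v = 0 := hv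
      simp only [mul_apply_eq_comp, h2, map_zero] at h1
      exact h1.symm) with h0 | h0
  · right
    ext v
    have : funRep ρ (traceFun ψ) v ∈ LinearMap.ker (funRep ρ (traceFun φ)).toLinearMap :=
      congrArg (fun T : H →L[ℂ] H => T v) hprod
    rw [h0] at this
    exact this
  · left
    ext v
    have : v ∈ LinearMap.ker (funRep ρ (traceFun φ)).toLinearMap := h0 ▸ Submodule.mem_top
    exact this

/-- An irreducible representation is carried by a single conjugacy class. -/
lemma IsIrreducibleRep.exists_angle {ρ : DSU2 →⋆ₐ[ℂ] (H →L[ℂ] H)} (hρ : IsIrreducibleRep ρ) :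
    ∃ θ ∈ Set.Icc 0 Real.pi, ∀ f : C(SU2, ℂ), (∀ u : SU2, f (u * hTheta θ * u⁻¹) = 0) →
      funRep ρ f = 0 := by
  have hnt := hρ.1
  let I : Ideal C(SU2, ℂ) := RingHom.ker (funRep ρ)
  have hI : ∀ f, f ∈ I ↔ funRep ρ f = 0 := fun f => RingHom.mem_ker
  have hclosed : IsClosed (I : Set C(SU2, ℂ)) := by
    have : (I : Set C(SU2, ℂ)) = funRep ρ ⁻¹' {0} := by ext f; exact hI f
    rw [this]
    exact isClosed_singleton.preimage (continuous_funRep ρ)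
  -- A closed ideal of `C(SU2, ℂ)` consists of all functions vanishing on its zero set, which is the
  -- complement of `setOfIdeal I`. It remains to see that the zero set lies in one class.
  have hset := ContinuousMap.idealOfSet_ofIdeal_isClosed hclosed
  have hne : ∃ g₀, g₀ ∉ ContinuousMap.setOfIdeal I := by
    by_contra! hcon
    have h1 : (1 : C(SU2, ℂ)) ∈ I := by
      rw [← hset, ContinuousMap.mem_idealOfSet]
      exact fun x hx => absurd (hcon x) hx
    rw [hI, map_one] at h1
    exact one_ne_zero h1
  have hlt : ∀ g g', g ∉ ContinuousMap.setOfIdeal I → g' ∉ ContinuousMap.setOfIdeal I →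
      ¬ halfTrace g < halfTrace g' := by
    intro g g' hg hg' hlt
    rw [ContinuousMap.notMem_setOfIdeal] at hg hg'
    obtain ⟨c, hc1, hc2⟩ := exists_between hlt
    -- Two ramps with product zero, nonzero at the larger and at the smaller trace value
    -- respectively; one of them must act by zero, although it does not vanish at a point of the
    -- zero set.
    let φ : C(ℝ, ℂ) := ⟨fun t => ((max (t - c) 0 : ℝ) : ℂ), by fun_prop⟩
    let ψ : C(ℝ, ℂ) := ⟨fun t => ((max (c - t) 0 : ℝ) : ℂ), by fun_prop⟩
    have hφψ : φ * ψ = 0 := by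
      ext t
      change ((max (t - c) 0 : ℝ) : ℂ) * ((max (c - t) 0 : ℝ) : ℂ) = 0
      rcases le_total t c with h | h
      · rw [max_eq_right (sub_nonpos.mpr h)]; simp
      · rw [max_eq_right (sub_nonpos.mpr h : c - t ≤ 0)]; simp
    rcases hρ.eq_zero_or_eq_zero hφψ with h | h
    · have h1 : ((max (halfTrace g' - c) 0 : ℝ) : ℂ) = 0 := hg' ((hI _).mpr h)
      rw [Complex.ofReal_eq_zero] at h1
      linarith [le_max_left (halfTrace g' - c) 0]
    · have h1 : ((max (c - halfTrace g) 0 : ℝ) : ℂ) = 0 := hg ((hI _).mpr h)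
      rw [Complex.ofReal_eq_zero] at h1
      linarith [le_max_left (c - halfTrace g) 0]
  obtain ⟨g₀, hg₀⟩ := hne
  obtain ⟨θ, hθ, u₀, hu₀⟩ := SU2Double.exists_angle g₀
  refine ⟨θ, hθ, fun f hf => ?_⟩
  rw [← hI, ← hset, ContinuousMap.mem_idealOfSet]
  intro g hg
  have h1 : halfTrace g = halfTrace g₀ :=
    le_antisymm (not_lt.mp (hlt _ _ hg₀ hg)) (not_lt.mp (hlt _ _ hg hg₀))
  rw [hu₀, halfTrace_conj, halfTrace_hTheta] at h1
  obtain ⟨u, rfl⟩ := exists_conj_hTheta h1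
  exact hf u

/-! ### The state of an invariant vector -/

lemma inner_tens (ρ : DSU2 →⋆ₐ[ℂ] (H →L[ℂ] H)) {ω : H} (hω : ω ∈ invVectors ρ) (x : SU2)
    (f : C(SU2, ℂ)) : ⟪ω, ρ (DSU2.tens x f) ω⟫_ℂ = ⟪ω, funRep ρ f ω⟫_ℂ := by
  rw [rho_tens, mul_apply_eq_comp, inner_groupAct, hω]

lemma inner_adPull (ρ : DSU2 →⋆ₐ[ℂ] (H →L[ℂ] H)) {ω : H} (hω : ω ∈ invVectors ρ) (x : SU2)
    (f : C(SU2, ℂ)) : ⟪ω, funRep ρ (adPull x f) ω⟫_ℂ = ⟪ω, funRep ρ f ω⟫_ℂ := by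
  have h := inner_tens ρ hω x⁻¹ f
  rwa [rho_tens', mul_apply_eq_comp, hω, inv_inv] at h

/-- The average of a function over conjugations. -/
noncomputable def classAverage (f : C(SU2, ℂ)) : C(SU2, ℂ) := ∫ g, adPull g f ∂haar

lemma integrable_adPull (f : C(SU2, ℂ)) : Integrable (fun g => adPull g f) haar :=
  (continuous_adPull f).integrable_of_hasCompactSupport (HasCompactSupport.of_compactSpace _)

lemma classAverage_apply (f : C(SU2, ℂ)) (a : SU2) :
    classAverage f a = ∫ g, f (g * a * g⁻¹) ∂haar :=
  ((ContinuousMap.evalCLM ℂ a).integral_comp_comm (integrable_adPull f)).symm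

lemma classAverage_conj (f : C(SU2, ℂ)) (u a : SU2) :
    classAverage f (u * a * u⁻¹) = classAverage f a := by
  rw [classAverage_apply, classAverage_apply,
    ← integral_mul_right_eq_self (fun g => f (g * a * g⁻¹)) u]
  simp only [mul_inv_rev, mul_assoc]

/-- The state defined by an invariant vector is the normalised orbital integral. -/
lemma inner_funRep_eq_integral {ρ : DSU2 →⋆ₐ[ℂ] (H →L[ℂ] H)} {θ : ℝ}
    (hθ : ∀ f : C(SU2, ℂ), (∀ u : SU2, f (u * hTheta θ * u⁻¹) = 0) → funRep ρ f = 0)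
    {ω : H} (hω : ω ∈ invVectors ρ) (hω1 : ‖ω‖ = 1) (f : C(SU2, ℂ)) :
    ⟪ω, funRep ρ f ω⟫_ℂ = ∫ g, f (g * hTheta θ * g⁻¹) ∂haar := by
  let Λ : C(SU2, ℂ) →L[ℂ] ℂ :=
    ⟨{ toFun := fun f => ⟪ω, funRep ρ f ω⟫_ℂ
       map_add' := fun f g => by rw [map_add, add_apply, inner_add_right]
       map_smul' := fun c f => by
        rw [map_smul, smul_apply, inner_smul_right]; rfl },
     continuous_const.inner ((continuous_funRep ρ).clm_apply continuous_const)⟩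
  have hΛ : ∀ f, Λ f = ⟪ω, funRep ρ f ω⟫_ℂ := fun f => rfl
  -- A continuous conjugation-invariant functional does not see the averaging.
  have h1 : Λ (classAverage f) = Λ f := by
    rw [classAverage, ← Λ.integral_comp_comm (integrable_adPull f)]
    simp only [hΛ, inner_adPull ρ hω]
    simp
  -- The average is constant on the class that carries `ρ`, so it acts there as a scalar.
  have h2 : funRep ρ (classAverage f - algebraMap ℂ _ (classAverage f (hTheta θ))) = 0 :=
    hθ _ fun u => by
      rw [ContinuousMap.sub_apply, classAverage_conj]; exact sub_self _
  rw [map_sub, sub_eq_zero, AlgHomClass.commutes] at h2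
  rw [← hΛ, ← h1, hΛ, h2, ← classAverage_apply, Algebra.algebraMap_eq_smul_one, smul_apply,
    one_apply_eq_self, inner_smul_right, inner_self_eq_norm_sq_to_K, hω1]
  simp

end

lemma funRep_rep_eq_zero (θ : ℝ) (f : C(SU2, ℂ)) (hf : ∀ u : SU2, f (u * hTheta θ * u⁻¹) = 0) :
    funRep (rep θ 0) f = 0 := by
  have h0 : orbitPull (hTheta θ) f = 0 := ContinuousMap.ext hf
  refine ContinuousLinearMap.ext fun v => Subtype.ext ?_
  rw [coe_funRep_rep, h0]
  exact congrArg (fun T : L2 →L[ℂ] L2 => T v) (map_zero mulRep)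

lemma omegaOne_mem (θ : ℝ) : omegaOne θ ∈ invVectors (rep θ 0) :=
  (mem_invVectors_rep_iff θ _).mpr ⟨1, (one_smul _ _).symm⟩

lemma omegaOne_ne_zero (θ : ℝ) : omegaOne θ ≠ 0 := fun h => by
  have := norm_omegaOne θ
  rw [h, norm_zero] at this
  exact zero_ne_one this

lemma inner_rep_tens (θ : ℝ) (x : SU2) (f : C(SU2, ℂ)) :
    ⟪omegaOne θ, rep θ 0 (DSU2.tens x f) (omegaOne θ)⟫_ℂ = ∫ g, f (g * hTheta θ * g⁻¹) ∂haar := by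
  rw [inner_tens _ (omegaOne_mem θ), inner_funRep_eq_integral (funRep_rep_eq_zero θ)
    (omegaOne_mem θ) (norm_omegaOne θ)]

lemma funRep_rep_traceFun (θ : ℝ) (φ : C(ℝ, ℂ)) :
    funRep (rep θ 0) (traceFun φ) = φ (Real.cos θ) • 1 := by
  have h := funRep_rep_eq_zero θ (traceFun φ - algebraMap ℂ _ (φ (Real.cos θ))) fun u => by
    rw [ContinuousMap.sub_apply, traceFun_apply, halfTrace_conj, halfTrace_hTheta]
    exact sub_self _
  rwa [map_sub, sub_eq_zero, AlgHomClass.commutes, Algebra.algebraMap_eq_smul_one] at h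

section

variable {H : Type*} [NormedAddCommGroup H] [InnerProductSpace ℂ H] [CompleteSpace H]

/-- Half the trace acts on `(θ, 0)` by the scalar `cos θ`, which unitary equivalence preserves. -/
lemma cos_eq_of_unitarilyEquivalent {ρ : DSU2 →⋆ₐ[ℂ] (H →L[ℂ] H)} {θ θ' : ℝ}
    (h : UnitarilyEquivalent ρ (rep θ 0)) (h' : UnitarilyEquivalent ρ (rep θ' 0)) :
    Real.cos θ = Real.cos θ' := by
  let φ : C(ℝ, ℂ) := ⟨fun t => (t : ℂ), Complex.continuous_ofReal⟩
  have key : ∀ {θ : ℝ}, UnitarilyEquivalent ρ (rep θ 0) → ∀ v,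
      funRep ρ (traceFun φ) v = (Real.cos θ : ℂ) • v := by
    rintro θ ⟨U, hU⟩ v
    apply U.injective
    rw [funRep_apply, hU, ← funRep_apply, funRep_rep_traceFun, map_smul]
    rfl
  obtain ⟨U, -⟩ := id h
  have hv : U.symm (omegaOne θ) ≠ 0 := fun h0 =>
    omegaOne_ne_zero θ (by rw [← U.apply_symm_apply (omegaOne θ), h0, map_zero])
  have h1 := (key h _).symm.trans (key h' (U.symm (omegaOne θ)))
  exact_mod_cast smul_left_injective ℂ hv h1

/-- Both cyclic invariant vectors define the same state, the orbital integral, so GNS uniqueness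
applies. The angle is unique because `cos` is injective on `[0, π]`. -/
lemma IsSimple.existsUnique_angle {ρ : DSU2 →⋆ₐ[ℂ] (H →L[ℂ] H)} (hρ : IsSimple ρ) :
    ∃! θ : ℝ, θ ∈ Set.Icc 0 Real.pi ∧ UnitarilyEquivalent ρ (rep θ 0) := by
  obtain ⟨θ, hθ, hvan⟩ := hρ.irreducible.exists_angle
  obtain ⟨ω, hω, hω1⟩ := hρ.exists_unit_invVector
  have hω0 : ω ≠ 0 := fun h => by rw [h, norm_zero] at hω1; exact zero_ne_one hω1
  have hU : UnitarilyEquivalent ρ (rep θ 0) := by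
    refine unitarilyEquivalent_of_inner (hρ.irreducible.denseRange hω0)
      ((isIrreducibleRep_rep θ).denseRange (omegaOne_ne_zero θ)) fun X => ?_
    induction X using DSU2.induction with
    | h0 => simp
    | hadd X Y hX hY =>
      rw [map_add, add_apply, inner_add_right, hX, hY, map_add, add_apply, inner_add_right]
    | ht x f => rw [inner_rep_tens, inner_tens _ hω, inner_funRep_eq_integral hvan hω hω1]
  refine ⟨θ, ⟨hθ, hU⟩, fun θ' h' => ?_⟩
  exact Real.injOn_cos h'.1 hθ (cos_eq_of_unitarilyEquivalent h'.2 hU)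

/-! ### The symmetric kernel and propagator -/

lemma unit_invVector_rep_iff (θ : ℝ) (v : vSpace θ 0) :
    (v ∈ invVectors (rep θ 0) ∧ ‖v‖ = 1) ↔ ∃ c : ℂ, ‖c‖ = 1 ∧ v = c • omegaOne θ := by
  rw [mem_invVectors_rep_iff]
  constructor
  · rintro ⟨⟨c, rfl⟩, h⟩
    exact ⟨c, by rwa [norm_smul, norm_omegaOne, mul_one] at h, rfl⟩
  · rintro ⟨c, hc, rfl⟩
    exact ⟨⟨c, rfl⟩, by rw [norm_smul, norm_omegaOne, hc, mul_one]⟩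

lemma isNormalizedPair_rep_iff (θ : ℝ) (φ : vSpace θ 0 →L[ℂ] ℂ) :
    IsNormalizedPair (rep θ 0) φ (omegaOne θ) ↔ φ = innerSL ℂ (omegaOne θ) := by
  have hform := invForms_eq_of_invVectors (mem_invVectors_rep_iff θ)
  have h1 := innerSL_self_of_norm_one (norm_omegaOne θ)
  constructor
  · rintro ⟨-, -, h2, h3⟩
    obtain ⟨c, rfl⟩ := (hform φ).mp h2
    rw [smul_apply, h1, smul_eq_mul, mul_one] at h3
    rw [h3, one_smul]
  · rintro rfl
    exact ⟨omegaOne_mem θ, norm_omegaOne θ, (hform _).mpr ⟨1, (one_smul _ _).symm⟩, h1⟩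

/-- Transported to the model, `ω` becomes `c` times the constant function and `φ` becomes `d` times
its inner product. The normalisation `φ ω = 1` says `d c = 1`, so both ambiguities cancel in the
kernel. -/
lemma symKernel_tens {ρ : DSU2 →⋆ₐ[ℂ] (H →L[ℂ] H)} {θ : ℝ} {φ : H →L[ℂ] ℂ} {ω : H}
    (hU : UnitarilyEquivalent ρ (rep θ 0)) (hp : IsNormalizedPair ρ φ ω) (x : SU2)
    (f : C(SU2, ℂ)) :
    symKernel ρ φ ω (DSU2.tens x f) = ∫ g, f (g * hTheta θ * g⁻¹) ∂haar := by
  obtain ⟨U, hU⟩ := hU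
  obtain ⟨c, hc⟩ := (mem_invVectors_rep_iff θ (U ω)).mp fun y => by
    rw [groupAct, ← hU]; exact congrArg U (hp.vec_mem y)
  have hU' : ∀ X v, U.symm (rep θ 0 X v) = ρ X (U.symm v) := fun X v => by
    rw [U.symm_apply_eq, hU, U.apply_symm_apply]
  obtain ⟨d, hd⟩ := (invForms_eq_of_invVectors (mem_invVectors_rep_iff θ)
    (φ ∘L (U.symm.toContinuousLinearEquiv : vSpace θ 0 →L[ℂ] H))).mp fun y v => by
      change φ (U.symm (groupAct (rep θ 0) y v)) = φ (U.symm v)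
      rw [groupAct, hU']
      exact hp.form_mem y _
  have hφ : ∀ v, φ v = d * ⟪omegaOne θ, U v⟫_ℂ := fun v => by
    have := congrArg (fun T : vSpace θ 0 →L[ℂ] ℂ => T (U v)) hd
    change φ (U.symm (U v)) = d * ⟪omegaOne θ, U v⟫_ℂ at this
    rwa [U.symm_apply_apply] at this
  have hcd : d * c = 1 := by
    have h1 := hφ ω
    rw [hp.pairing, hc, inner_smul_right (𝕜 := ℂ) (E := vSpace θ 0)] at h1
    rw [h1, ← innerSL_apply_apply ℂ, innerSL_self_of_norm_one (norm_omegaOne θ), mul_one]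
  change φ (ρ (DSU2.tens x f) ω) = _
  rw [hφ, hU, hc, map_smul, inner_smul_right (𝕜 := ℂ) (E := vSpace θ 0), ← mul_assoc, hcd, one_mul, inner_rep_tens]

namespace DSU2

/-- The linear map `x ⊗ f ↦ f`. -/
noncomputable def total : DSU2 →ₗ[ℂ] C(SU2, ℂ) := lift fun _ => LinearMap.id

lemma total_tens (x : SU2) (f : C(SU2, ℂ)) : total (tens x f) = f := lift_tens _ x f

lemma dualTens_one (g : SU2) (X : DSU2) : dualTens 1 g X = total X g := by
  induction X using DSU2.induction with
  | h0 => simp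
  | hadd X Y hX hY => rw [map_add, map_add, hX, hY]; rfl
  | ht x f => rw [dualTens_tens, total_tens]; simp

end DSU2

/-- The function `g ↦ f(g⁻¹)`. -/
noncomputable def invFun (f : C(SU2, ℂ)) : C(SU2, ℂ) := f.comp ⟨fun g => g⁻¹, continuous_inv⟩

lemma invFun_apply (f : C(SU2, ℂ)) (g : SU2) : invFun f g = f g⁻¹ := rfl

lemma integrable_orbit (θ : ℝ) (f : C(SU2, ℂ)) :
    Integrable (fun g => f (g * hTheta θ * g⁻¹)) haar :=
  ContinuousMap.integrable_haar (orbitPull (hTheta θ) f)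

lemma symKernel_eq {ρ : DSU2 →⋆ₐ[ℂ] (H →L[ℂ] H)} {θ : ℝ} {φ : H →L[ℂ] ℂ} {ω : H}
    (hU : UnitarilyEquivalent ρ (rep θ 0)) (hp : IsNormalizedPair ρ φ ω) (X : DSU2) :
    symKernel ρ φ ω X = ∫ g, DSU2.total X (g * hTheta θ * g⁻¹) ∂haar := by
  induction X using DSU2.induction with
  | h0 => simp
  | hadd X Y hX hY =>
    rw [map_add, map_add, hX, hY, ← integral_add (integrable_orbit θ _) (integrable_orbit θ _)]
    rfl
  | ht x f => rw [symKernel_tens hU hp, DSU2.total_tens]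

lemma propagator_eq {ρ : DSU2 →⋆ₐ[ℂ] (H →L[ℂ] H)} {θ : ℝ} {φ : H →L[ℂ] ℂ} {ω : H}
    (hU : UnitarilyEquivalent ρ (rep θ 0)) (hp : IsNormalizedPair ρ φ ω) (X Y : DSU2) :
    propagator (symKernel ρ φ ω) X Y =
      ∫ g, (DSU2.total X * invFun (DSU2.total Y)) (g * hTheta θ * g⁻¹) ∂haar := by
  induction X using DSU2.induction with
  | h0 => simp
  | hadd X X' hX hX' =>
    rw [map_add, LinearMap.add_apply, map_add, hX, hX', add_mul,
      ← integral_add (integrable_orbit θ _) (integrable_orbit θ _)]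
    rfl
  | ht x f =>
    induction Y using DSU2.induction with
    | h0 =>
      have : invFun 0 = 0 := rfl
      simp [this]
    | hadd Y Y' hY hY' =>
      have : ∀ k k' : C(SU2, ℂ), invFun (k + k') = invFun k + invFun k' := fun k k' => rfl
      rw [map_add, map_add, hY, hY', this, mul_add,
        ← integral_add (integrable_orbit θ _) (integrable_orbit θ _)]
      rfl
    | ht y k =>
      rw [propagator_apply, DSU2.antipode_tens, DSU2.tens_mul_tens, symKernel_tens hU hp,
        -- Both factors of the product are conjugated by `y`; the substitution `g ↦ y g` undoes
        -- this.
        DSU2.total_tens, DSU2.total_tens,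
        ← integral_mul_left_eq_self (fun g => (adPull y⁻¹ f * DSU2.invPull y k)
          (g * hTheta θ * g⁻¹)) y]
      refine integral_congr_ae (ae_of_all _ fun g => ?_)
      simp only [ContinuousMap.mul_apply, adPull_apply, DSU2.invPull_apply, invFun_apply]
      congr 2 <;> group

end

/-! ### The invariant measure on a conjugacy class -/

/-- The conjugation-invariant probability measure on the class of `h`. -/
noncomputable def classDelta (h : SU2) : Measure SU2 := haar.map fun g => g * h * g⁻¹

lemma measurable_orbit (h : SU2) : Measurable fun g : SU2 => g * h * g⁻¹ :=
  ((continuous_id.mul continuous_const).mul continuous_inv).measurable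

lemma measurableSet_conj (h : SU2) : MeasurableSet {g | IsConj h g} := by
  have : {g | IsConj h g} = Set.range fun u : SU2 => u * h * u⁻¹ := by
    ext g; exact isConj_iff
  rw [this]
  exact (isCompact_range ((continuous_id.mul continuous_const).mul
    continuous_inv)).isClosed.measurableSet

lemma isClassDelta_classDelta (h : SU2) : IsClassDelta h (classDelta h) where
  prob := Measure.isProbabilityMeasure_map (measurable_orbit h).aemeasurable
  conj_invariant u := by
    have h2 : (fun g => u * g * u⁻¹) ∘ (fun g : SU2 => g * h * g⁻¹) =
        (fun g => g * h * g⁻¹) ∘ fun g => u * g := by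
      ext g : 1
      simp [mul_assoc]
    rw [classDelta, Measure.map_map (by fun_prop) (measurable_orbit h), h2,
      ← Measure.map_map (measurable_orbit h) (by fun_prop), map_mul_left_eq_self]
  carried := by
    rw [classDelta, Measure.map_apply (measurable_orbit h) (measurableSet_conj h).compl]
    have : (fun g : SU2 => g * h * g⁻¹) ⁻¹' {g | IsConj h g}ᶜ = ∅ := by
      ext g
      simp only [Set.mem_preimage, Set.mem_compl_iff, Set.mem_ofPred_eq, Set.mem_empty_iff_false,
        iff_false, not_not]
      exact isConj_iff.mpr ⟨g, rfl⟩
    rw [this, measure_empty]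

/-- Averaging `m` over conjugation does not change it. After Tonelli, the Haar average of the
conjugates of any single `g` in the class is already `classDelta h`. -/
lemma IsClassDelta.eq_classDelta {h : SU2} {m : Measure SU2} (hm : IsClassDelta h m) :
    m = classDelta h := by
  have := hm.prob
  refine Measure.ext fun A hA => ?_
  have hmeas : Measurable fun p : SU2 × SU2 => p.1 * p.2 * p.1⁻¹ :=
    ((continuous_fst.mul continuous_snd).mul continuous_fst.inv).measurable
  have hcarried : ∀ᵐ g ∂m, IsConj h g := hm.carried
  calc m A = ∫⁻ _u, m A ∂haar := by simp
    _ = ∫⁻ u, ∫⁻ g, A.indicator 1 (u * g * u⁻¹) ∂m ∂haar := by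
        refine lintegral_congr fun u => ?_
        conv_lhs => rw [← hm.conj_invariant u]
        rw [Measure.map_apply (by fun_prop) hA, ← lintegral_indicator_one
          ((by fun_prop : Measurable fun g : SU2 => u * g * u⁻¹) hA)]
        rfl
    _ = ∫⁻ g, ∫⁻ u, A.indicator 1 (u * g * u⁻¹) ∂haar ∂m :=
        lintegral_lintegral_swap ((measurable_one.indicator hA).comp hmeas).aemeasurable
    _ = ∫⁻ _g, classDelta h A ∂m := by
        refine lintegral_congr_ae ?_
        filter_upwards [hcarried] with g hg
        obtain ⟨c, rfl⟩ := isConj_iff.mp hg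
        rw [classDelta, ← lintegral_indicator_one hA, lintegral_map
          (measurable_one.indicator hA) (measurable_orbit h),
          ← lintegral_mul_right_eq_self (fun u => A.indicator 1 (u * h * u⁻¹)) c]
        simp only [mul_inv_rev, mul_assoc]
    _ = classDelta h A := by simp

lemma integral_classDelta (h : SU2) (f : C(SU2, ℂ)) :
    ∫ g, f g ∂classDelta h = ∫ g, f (g * h * g⁻¹) ∂haar :=
  integral_map (measurable_orbit h).aemeasurable f.continuous.aestronglyMeasurable

/-! ### Homogeneous polynomials in two variables -/

/-- The exponent of `X₀ᵏ X₁ʲ⁻ᵏ`. -/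
noncomputable def expo (j : ℕ) (k : Fin (j + 1)) : Fin 2 →₀ ℕ :=
  Finsupp.single 0 (k : ℕ) + Finsupp.single 1 (j - k)

lemma expo_zero (j : ℕ) (k : Fin (j + 1)) : expo j k 0 = k := by simp [expo]

lemma expo_one (j : ℕ) (k : Fin (j + 1)) : expo j k 1 = j - k := by simp [expo]

lemma expo_injective (j : ℕ) : Function.Injective (expo j) := fun k l h => by
  have := DFunLike.congr_fun h 0
  rw [expo_zero, expo_zero] at this
  exact Fin.ext this

lemma degree_expo (j : ℕ) (k : Fin (j + 1)) : (expo j k).degree = j := by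
  rw [Finsupp.degree_eq_sum, Fin.sum_univ_two, expo_zero, expo_one]
  omega

lemma exists_expo {j : ℕ} {d : Fin 2 →₀ ℕ} (hd : d.degree = j) : ∃ k, d = expo j k := by
  rw [Finsupp.degree_eq_sum, Fin.sum_univ_two] at hd
  refine ⟨⟨d 0, by omega⟩, ?_⟩
  ext i
  fin_cases i
  · change d 0 = expo j _ 0
    rw [expo_zero]
  · change d 1 = expo j _ 1
    rw [expo_one]
    change d 1 = j - d 0
    omega

lemma coeff_sum_monomial_expo {j : ℕ} (c : Fin (j + 1) → ℂ) (k : Fin (j + 1)) :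
    (∑ l, MvPolynomial.monomial (expo j l) (c l)).coeff (expo j k) = c k := by
  rw [MvPolynomial.coeff_sum, Finset.sum_eq_single k]
  · simp
  · intro l _ hl
    rw [MvPolynomial.coeff_monomial, if_neg fun h => hl (expo_injective j h)]
  · simp

lemma eq_sum_monomial {j : ℕ} {p : MvPolynomial (Fin 2) ℂ}
    (hp : p ∈ MvPolynomial.homogeneousSubmodule (Fin 2) ℂ j) :
    p = ∑ k, MvPolynomial.monomial (expo j k) (p.coeff (expo j k)) := by
  ext d
  by_cases hd : d.degree = j
  · obtain ⟨k, rfl⟩ := exists_expo hd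
    rw [coeff_sum_monomial_expo]
  · rw [MvPolynomial.IsHomogeneous.coeff_eq_zero hp hd, MvPolynomial.coeff_sum]
    refine (Finset.sum_eq_zero fun k _ => ?_).symm
    rw [MvPolynomial.coeff_monomial, if_neg]
    rintro rfl
    exact hd (degree_expo j k)

lemma monomial_mem (j : ℕ) (k : Fin (j + 1)) (c : ℂ) :
    MvPolynomial.monomial (expo j k) c ∈ MvPolynomial.homogeneousSubmodule (Fin 2) ℂ j :=
  MvPolynomial.isHomogeneous_monomial c (degree_expo j k)

/-- The basis of monomials. -/
noncomputable def monomialBasis (j : ℕ) :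
    Module.Basis (Fin (j + 1)) ℂ (MvPolynomial.homogeneousSubmodule (Fin 2) ℂ j) :=
  Module.Basis.ofEquivFun
    { toFun := fun p k => MvPolynomial.coeff (expo j k) p.1
      map_add' := fun p q => by ext k; simp
      map_smul' := fun c p => by ext k; simp
      invFun := fun c => ⟨∑ k, MvPolynomial.monomial (expo j k) (c k),
        Submodule.sum_mem _ fun k _ => monomial_mem j k _⟩
      left_inv := fun p => Subtype.ext (eq_sum_monomial p.2).symm
      right_inv := fun c => funext fun k => coeff_sum_monomial_expo c k }

lemma monomialBasis_repr (j : ℕ) (p : MvPolynomial.homogeneousSubmodule (Fin 2) ℂ j)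
    (k : Fin (j + 1)) : (monomialBasis j).repr p k = p.1.coeff (expo j k) := by
  rw [← Module.Basis.equivFun_apply, monomialBasis, Module.Basis.equivFun_ofEquivFun]
  rfl

lemma coe_monomialBasis (j : ℕ) (k : Fin (j + 1)) :
    (monomialBasis j k : MvPolynomial (Fin 2) ℂ) = MvPolynomial.monomial (expo j k) 1 := by
  rw [monomialBasis, Module.Basis.coe_ofEquivFun]
  change ∑ l, MvPolynomial.monomial (expo j l) ((Pi.single k 1 : Fin (j + 1) → ℂ) l) = _
  rw [Finset.sum_eq_single k]
  · simp
  · intro l _ hl; simp [hl]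
  · simp

lemma chi_eq_sum_coeff (j : ℕ) (g : SU2) :
    chi j g = ∑ k, (subst g.1 (MvPolynomial.monomial (expo j k) 1)).coeff (expo j k) := by
  rw [chi, Representation.character, LinearMap.trace_eq_matrix_trace ℂ (monomialBasis j),
    Matrix.trace]
  refine Finset.sum_congr rfl fun k _ => ?_
  rw [Matrix.diag_apply, LinearMap.toMatrix_apply, monomialBasis_repr, ← coe_monomialBasis]
  rfl

lemma continuous_coeff_subst (p : MvPolynomial (Fin 2) ℂ) (d : Fin 2 →₀ ℕ) :
    Continuous fun g : SU2 => (subst g.1 p).coeff d := by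
  induction p using MvPolynomial.induction_on generalizing d with
  | C a => simp only [subst, MvPolynomial.aeval_C]; exact continuous_const
  | add p q hp hq =>
    simp only [map_add, MvPolynomial.coeff_add]
    exact (hp d).add (hq d)
  | mul_X p i hp =>
    simp only [map_mul, MvPolynomial.coeff_mul]
    refine continuous_finsetSum _ fun x _ => (hp x.1).mul ?_
    simp only [subst, MvPolynomial.aeval_X, MvPolynomial.coeff_sum, MvPolynomial.coeff_smul]
    exact continuous_finsetSum _ fun k _ =>
      (continuous_subtype_val.matrix_elem k i).smul continuous_const

lemma eval_subst (g : Matrix (Fin 2) (Fin 2) ℂ) (v : Fin 2 → ℂ) (p : MvPolynomial (Fin 2) ℂ) :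
    MvPolynomial.eval v (subst g p) = MvPolynomial.eval (Matrix.vecMul v g) p := by
  induction p using MvPolynomial.induction_on with
  | C a => simp [subst]
  | add p q hp hq => simp only [map_add, hp, hq]
  | mul_X p i hp =>
    rw [map_mul, map_mul, map_mul, hp, MvPolynomial.eval_X]
    congr 1
    simp [subst, Matrix.vecMul, dotProduct, MvPolynomial.smul_eval, mul_comm]

lemma eval_monomial_expo (j : ℕ) (k : Fin (j + 1)) (c : ℂ) (v : Fin 2 → ℂ) :
    MvPolynomial.eval v (MvPolynomial.monomial (expo j k) c) =
      c * (v 0 ^ (k : ℕ) * v 1 ^ (j - k : ℕ)) := by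
  rw [MvPolynomial.eval_monomial, Finsupp.prod_fintype _ _ (fun _ => pow_zero _),
    Fin.prod_univ_two, expo_zero, expo_one]

lemma eval_eq_sum {j : ℕ} {p : MvPolynomial (Fin 2) ℂ}
    (hp : p ∈ MvPolynomial.homogeneousSubmodule (Fin 2) ℂ j) (v : Fin 2 → ℂ) :
    MvPolynomial.eval v p =
      ∑ k, p.coeff (expo j k) * (v 0 ^ (k : ℕ) * v 1 ^ (j - k : ℕ)) := by
  conv_lhs => rw [eq_sum_monomial hp]
  rw [map_sum]
  exact Finset.sum_congr rfl fun k _ => eval_monomial_expo j k _ v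

lemma eval_smul {j : ℕ} {p : MvPolynomial (Fin 2) ℂ}
    (hp : p ∈ MvPolynomial.homogeneousSubmodule (Fin 2) ℂ j) (c : ℂ) (v : Fin 2 → ℂ) :
    MvPolynomial.eval (c • v) p = c ^ j * MvPolynomial.eval v p := by
  rw [eval_eq_sum hp, eval_eq_sum hp, Finset.mul_sum]
  refine Finset.sum_congr rfl fun k _ => ?_
  have hk : (k : ℕ) + (j - k) = j := by omega
  rw [Pi.smul_apply, Pi.smul_apply, smul_eq_mul, smul_eq_mul, mul_pow, mul_pow]
  calc _ = c ^ ((k : ℕ) + (j - k)) * (p.coeff (expo j k) * (v 0 ^ (k : ℕ) * v 1 ^ (j - k : ℕ))) := by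
        rw [pow_add]; ring
    _ = _ := by rw [hk]

/-- The mean of a non-constant homogeneous polynomial over an orbit of `SU(2)` vanishes. -/
lemma integral_eval_vecMul {j : ℕ} (hj : j ≠ 0) {p : MvPolynomial (Fin 2) ℂ}
    (hp : p ∈ MvPolynomial.homogeneousSubmodule (Fin 2) ℂ j) (v : Fin 2 → ℂ) :
    ∫ g : SU2, MvPolynomial.eval (Matrix.vecMul v g.1) p ∂haar = 0 := by
  have hinv : ∀ (u : SU2) (v : Fin 2 → ℂ), ∫ g : SU2, MvPolynomial.eval (Matrix.vecMul (Matrix.vecMul v u.1) g.1) p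
      ∂haar = ∫ g : SU2, MvPolynomial.eval (Matrix.vecMul v g.1) p ∂haar := fun u v => by
    rw [← integral_mul_left_eq_self (fun g : SU2 => MvPolynomial.eval (Matrix.vecMul v g.1) p) u]
    simp only [Matrix.vecMul_vecMul, Submonoid.coe_mul]
  have hsmul : ∀ (c : ℂ) (v : Fin 2 → ℂ), ∫ g : SU2, MvPolynomial.eval (Matrix.vecMul (c • v) g.1) p
      ∂haar = c ^ j * ∫ g : SU2, MvPolynomial.eval (Matrix.vecMul v g.1) p ∂haar := fun c v => by
    simp only [Matrix.smul_vecMul, eval_smul hp, integral_const_mul]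
  have h0 : ∫ g : SU2, MvPolynomial.eval (Matrix.vecMul ![1, 0] g.1) p ∂haar = 0 := by
    -- The row vector `![1, 0]` is an eigenvector with eigenvalue `e^{iπ/j}`, whose `j`-th power is
    -- `-1`, so the integral equals its own negative.
    have h1 := hinv (hTheta (Real.pi / j)) ![1, 0]
    have h2 : Matrix.vecMul ![1, 0] (hTheta (Real.pi / j)).1 =
        Complex.exp (((Real.pi / j : ℝ) : ℂ) * Complex.I) • ![1, 0] := by
      ext i; fin_cases i <;> simp [hTheta, Matrix.vecMul, dotProduct]
    have h3 : (j : ℂ) * (((Real.pi / j : ℝ) : ℂ) * Complex.I) = Real.pi * Complex.I := by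
      have hj' : (j : ℂ) ≠ 0 := by exact_mod_cast hj
      push_cast; field_simp
    rw [h2, hsmul, ← Complex.exp_nat_mul, h3, Complex.exp_pi_mul_I, neg_one_mul] at h1
    exact self_eq_neg.mp h1.symm
  by_cases hv : v = 0
  · have : v = (0 : ℂ) • ![1, 0] := by rw [hv, zero_smul]
    rw [this, hsmul, h0, mul_zero]
  have hN : 0 < ‖v 0‖ ^ 2 + ‖v 1‖ ^ 2 := by
    by_contra hN
    refine hv (funext fun i => norm_eq_zero.mp ?_)
    fin_cases i <;> simp only [Fin.zero_eta, Fin.mk_one] <;>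
      nlinarith [sq_nonneg ‖v 0‖, sq_nonneg ‖v 1‖]
  set N := ‖v 0‖ ^ 2 + ‖v 1‖ ^ 2
  set r : ℝ := Real.sqrt N
  have hr : r ^ 2 = N := Real.sq_sqrt hN.le
  have hr0 : (r : ℂ) ≠ 0 := by
    have : 0 < r := Real.sqrt_pos.mpr hN
    exact_mod_cast this.ne'
  -- The first row of `ofColumn a b` is `(a, -conj b)`; this choice of `b` makes that row equal to
  -- `v / r`.
  have hw : ‖(r : ℂ)⁻¹ * v 0‖ ^ 2 + ‖-starRingEnd ℂ ((r : ℂ)⁻¹ * v 1)‖ ^ 2 = 1 := by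
    rw [norm_neg, RCLike.norm_conj, norm_mul, norm_mul, norm_inv, Complex.norm_real, mul_pow, mul_pow, Real.norm_eq_abs,
      inv_pow, sq_abs, ← mul_add, hr]
    exact inv_mul_cancel₀ hN.ne'
  have h4 : v = (r : ℂ) • Matrix.vecMul ![1, 0] (ofColumn _ _ hw).1 := by
    ext i
    fin_cases i <;> simp [ofColumn, mul_inv_cancel_left₀ hr0]
  rw [h4, hsmul, hinv, h0, mul_zero]

lemma integrable_of_continuous {u : SU2 → ℂ} (hu : Continuous u) : Integrable u haar :=
  ContinuousMap.integrable_haar ⟨u, hu⟩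

/-- The polynomial with the integrated coefficients takes the value zero at every point, by
`integral_eval_vecMul`, hence is zero. -/
lemma integral_coeff_subst {j : ℕ} (hj : j ≠ 0) {p : MvPolynomial (Fin 2) ℂ}
    (hp : p ∈ MvPolynomial.homogeneousSubmodule (Fin 2) ℂ j) (k : Fin (j + 1)) :
    ∫ g : SU2, (subst g.1 p).coeff (expo j k) ∂haar = 0 := by
  have h1 : ∑ l, MvPolynomial.monomial (expo j l) (∫ g : SU2, (subst g.1 p).coeff (expo j l) ∂haar)
      = 0 := by
    refine MvPolynomial.funext fun v => ?_
    rw [map_zero, map_sum, ← integral_eval_vecMul hj hp v]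
    simp only [← eval_subst, eval_eq_sum (subst_mem _ hp), eval_monomial_expo]
    rw [integral_finsetSum _ fun l _ =>
      (integrable_of_continuous (continuous_coeff_subst p _)).mul_const _]
    exact Finset.sum_congr rfl fun l _ => (integral_mul_const _ _).symm
  rw [← coeff_sum_monomial_expo (fun l => ∫ g : SU2, (subst g.1 p).coeff (expo j l) ∂haar) k, h1,
    MvPolynomial.coeff_zero]

/-! ### Characters -/

lemma continuous_chi (j : ℕ) : Continuous (chi j) := by
  have : chi j = fun g => _ := funext (chi_eq_sum_coeff j)
  rw [this]
  exact continuous_finsetSum _ fun k _ => continuous_coeff_subst _ _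

lemma chi_conj (j : ℕ) (u g : SU2) : chi j (u * g * u⁻¹) = chi j g :=
  Representation.char_conj _ _ _

lemma integral_chi {j : ℕ} (hj : j ≠ 0) : ∫ g, chi j g ∂haar = 0 := by
  simp only [chi_eq_sum_coeff]
  rw [integral_finsetSum _ fun k _ => integrable_of_continuous (continuous_coeff_subst _ _)]
  exact Finset.sum_eq_zero fun k _ => integral_coeff_subst hj (monomial_mem j k 1) k

lemma chi_hTheta (j : ℕ) (θ : ℝ) :
    chi j (hTheta θ) = ∑ k ∈ Finset.range (j + 1),
      Complex.exp (θ * Complex.I) ^ k * Complex.exp (-(θ * Complex.I)) ^ (j - k) := by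
  rw [chi_eq_sum_coeff, Finset.sum_range]
  refine Finset.sum_congr rfl fun k _ => ?_
  have h0 : subst (hTheta θ).1 (MvPolynomial.X 0) =
      Complex.exp (θ * Complex.I) • MvPolynomial.X 0 := by
    simp [subst, hTheta]
  have h1 : subst (hTheta θ).1 (MvPolynomial.X 1) =
      Complex.exp (-(θ * Complex.I)) • MvPolynomial.X 1 := by
    simp [subst, hTheta]
  have h2 : (MvPolynomial.monomial (expo j k) 1 : MvPolynomial (Fin 2) ℂ) =
      MvPolynomial.X 0 ^ (k : ℕ) * MvPolynomial.X 1 ^ (j - k : ℕ) := by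
    rw [MvPolynomial.monomial_eq, Finsupp.prod_fintype _ _ (fun _ => pow_zero _),
      Fin.prod_univ_two, expo_zero, expo_one, map_one, one_mul]
  rw [h2, map_mul, map_pow, map_pow, h0, h1, smul_pow, smul_pow, smul_mul_smul_comm, ← h2,
    MvPolynomial.coeff_smul, MvPolynomial.coeff_monomial, if_pos rfl, smul_eq_mul, mul_one]

/-- A class function is determined by its values on the torus. -/
lemma class_ext {α : Type*} {f f' : SU2 → α} (hf : ∀ u g, f (u * g * u⁻¹) = f g)
    (hf' : ∀ u g, f' (u * g * u⁻¹) = f' g) (h : ∀ θ, f (hTheta θ) = f' (hTheta θ)) (g : SU2) :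
    f g = f' g := by
  obtain ⟨θ, -, u, rfl⟩ := exists_angle g
  rw [hf, hf', h]

lemma exp_mul_exp_neg (z : ℂ) : Complex.exp z * Complex.exp (-z) = 1 := by
  rw [← Complex.exp_add, add_neg_cancel, Complex.exp_zero]

lemma chi_hTheta_succ (j : ℕ) (θ : ℝ) : chi (j + 1) (hTheta θ) =
    Complex.exp (-(θ * Complex.I)) * chi j (hTheta θ) + Complex.exp (θ * Complex.I) ^ (j + 1) := by
  rw [chi_hTheta, chi_hTheta, Finset.sum_range_succ, Nat.sub_self, pow_zero, mul_one,
    Finset.mul_sum]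
  congr 1
  refine Finset.sum_congr rfl fun k hk => ?_
  rw [Nat.succ_sub (Finset.mem_range_succ_iff.mp hk), pow_succ]
  ring

lemma chi_hTheta_succ' (j : ℕ) (θ : ℝ) : chi (j + 1) (hTheta θ) =
    Complex.exp (θ * Complex.I) * chi j (hTheta θ) + Complex.exp (-(θ * Complex.I)) ^ (j + 1) := by
  rw [chi_hTheta, chi_hTheta, Finset.sum_range_succ', pow_zero, one_mul, Nat.sub_zero,
    Finset.mul_sum]
  congr 1
  refine Finset.sum_congr rfl fun k hk => ?_
  rw [Nat.succ_sub_succ, pow_succ]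
  ring

lemma chi_zero (g : SU2) : chi 0 g = 1 :=
  class_ext (f' := fun _ => (1 : ℂ)) (chi_conj 0) (fun _ _ => rfl)
    (fun θ => by simp [chi_hTheta]) g

lemma chi_one_hTheta (θ : ℝ) : chi 1 (hTheta θ) =
    Complex.exp (θ * Complex.I) + Complex.exp (-(θ * Complex.I)) := by
  rw [chi_hTheta_succ, chi_zero]; ring

/-- The weights of `χ_{j+2}` are those of `χ_j` together with the two extreme ones. This identity
drives the summation by parts in `hasSum_chi_of_hasSum`. -/
lemma chi_add_two_hTheta (j : ℕ) (θ : ℝ) : chi (j + 2) (hTheta θ) - chi j (hTheta θ) =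
    Complex.exp (θ * Complex.I) ^ (j + 2) + Complex.exp (-(θ * Complex.I)) ^ (j + 2) := by
  rw [chi_hTheta_succ, chi_hTheta_succ']
  linear_combination chi j (hTheta θ) * exp_mul_exp_neg (θ * Complex.I)

/-- The Clebsch–Gordan rule for the fundamental representation, checked on the torus. -/
lemma chi_one_mul (j : ℕ) (g : SU2) : chi 1 g * chi (j + 1) g = chi (j + 2) g + chi j g := by
  refine class_ext (f := fun g => chi 1 g * chi (j + 1) g) (f' := fun g => chi (j + 2) g + chi j g)
    (fun u g => by simp only [chi_conj]) (fun u g => by simp only [chi_conj]) (fun θ => ?_) g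
  simp only [chi_one_hTheta]
  linear_combination -chi_hTheta_succ (j + 1) θ + Complex.exp (θ * Complex.I) * chi_hTheta_succ j θ
    + chi j (hTheta θ) * exp_mul_exp_neg (θ * Complex.I)

lemma norm_chi_le (j : ℕ) (g : SU2) : ‖chi j g‖ ≤ j + 1 := by
  obtain ⟨θ, -, u, rfl⟩ := exists_angle g
  rw [chi_conj, chi_hTheta]
  refine (norm_sum_le _ _).trans ?_
  have h : ‖Complex.exp (-(θ * Complex.I))‖ = 1 := by
    have := Complex.norm_exp_ofReal_mul_I (-θ)
    rwa [Complex.ofReal_neg, neg_mul] at this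
  simp [norm_pow, Complex.norm_exp_ofReal_mul_I, h]

lemma integrable_chi_mul (j : ℕ) {u : SU2 → ℂ} (hu : Continuous u) :
    Integrable (fun g => chi j g * u g) haar :=
  integrable_of_continuous ((continuous_chi j).mul hu)

/-- Orthonormality of the characters. -/
lemma integral_chi_mul_chi (j k : ℕ) :
    ∫ g, chi j g * chi k g ∂haar = if j = k then 1 else 0 := by
  have hzero : ∀ j, ∫ g, chi j g * chi 0 g ∂haar = if j = 0 then 1 else 0 := fun j => by
    simp only [chi_zero, mul_one]
    split_ifs with h
    · subst h; simp [chi_zero]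
    · exact integral_chi h
  have hrec : ∀ i k, ∫ g, chi 1 g * chi (i + 1) g * chi k g ∂haar =
      ∫ g, chi (i + 2) g * chi k g ∂haar + ∫ g, chi i g * chi k g ∂haar := fun i k => by
    rw [← integral_add (integrable_chi_mul _ (continuous_chi _))
      (integrable_chi_mul _ (continuous_chi _))]
    simp only [chi_one_mul, add_mul]
  have hcomm : ∀ j k, ∫ g, chi j g * chi k g ∂haar = ∫ g, chi k g * chi j g ∂haar := fun j k => by
    simp only [mul_comm]
  have hone : ∀ j, ∫ g, chi j g * chi 1 g ∂haar = if j = 1 then 1 else 0 := fun j => by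
    rcases j with _ | j
    · rw [hcomm, hzero]; simp
    · have h := hrec j 0
      rw [hzero, hzero] at h
      have h2 : ∫ g, chi (j + 1) g * chi 1 g ∂haar = ∫ g, chi 1 g * chi (j + 1) g * chi 0 g ∂haar := by
        congr 1; ext g; rw [chi_zero]; ring
      rw [h2, h]
      simp
  -- The recursion has order two, so the induction carries two consecutive values of `k`. The step
  -- expands the integral of `χ_1 χ_{j+1} χ_{k+1}` in two ways.
  have main : ∀ k, (∀ j, ∫ g, chi j g * chi k g ∂haar = if j = k then 1 else 0) ∧
      ∀ j, ∫ g, chi j g * chi (k + 1) g ∂haar = if j = k + 1 then 1 else 0 := by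
    intro k
    induction k with
    | zero => exact ⟨hzero, hone⟩
    | succ k ih =>
      refine ⟨ih.2, fun j => ?_⟩
      rcases j with _ | j
      · rw [hcomm, hzero]; simp
      · have h1 := hrec j (k + 1)
        have h2 := hrec k (j + 1)
        have h3 : ∫ g, chi 1 g * chi (j + 1) g * chi (k + 1) g ∂haar =
            ∫ g, chi 1 g * chi (k + 1) g * chi (j + 1) g ∂haar := by
          congr 1; ext g; ring
        rw [ih.2, ih.2] at h1
        rw [hcomm (k + 2), hcomm k, ih.1] at h2
        rw [h3, h2] at h1
        rw [eq_sub_of_add_eq h1]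
        simp only [Nat.add_left_inj]
        split_ifs <;> first | omega | simp
  exact (main k).1 j

/-! ### Smooth functions -/

lemma isSmooth_zero : IsSmooth 0 := ⟨fun _ => 0, contDiff_const, fun _ => rfl⟩

lemma IsSmooth.add {f f' : C(SU2, ℂ)} (hf : IsSmooth f) (hf' : IsSmooth f') : IsSmooth (f + f') := by
  obtain ⟨F, hF, h⟩ := hf
  obtain ⟨F', hF', h'⟩ := hf'
  exact ⟨fun A => F A + F' A, hF.add hF', fun g => by rw [ContinuousMap.add_apply, h, h']⟩

lemma IsSmooth.mul {f f' : C(SU2, ℂ)} (hf : IsSmooth f) (hf' : IsSmooth f') : IsSmooth (f * f') := by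
  obtain ⟨F, hF, h⟩ := hf
  obtain ⟨F', hF', h'⟩ := hf'
  exact ⟨fun A => F A * F' A, hF.mul hF', fun g => by rw [ContinuousMap.mul_apply, h, h']⟩

lemma coe_inv_apply (g : SU2) (i j : Fin 2) : (g⁻¹).1 i j = starRingEnd ℂ (g.1 j i) := rfl

lemma contDiff_conj_entry {E : Type*} [NormedAddCommGroup E] [NormedSpace ℝ E] {u : E → ℂ}
    (hu : ContDiff ℝ ((⊤ : ℕ∞) : WithTop ℕ∞) u) :
    ContDiff ℝ ((⊤ : ℕ∞) : WithTop ℕ∞) fun x => starRingEnd ℂ (u x) :=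
  Complex.conjCLE.contDiff.comp hu

lemma IsSmooth.invFun {f : C(SU2, ℂ)} (hf : IsSmooth f) : IsSmooth (invFun f) := by
  obtain ⟨F, hF, h⟩ := hf
  refine ⟨fun A => F fun i j => starRingEnd ℂ (A j i), hF.comp ?_, fun g => ?_⟩
  · exact contDiff_pi.mpr fun i => contDiff_pi.mpr fun j => contDiff_conj_entry (by fun_prop)
  · rw [invFun_apply, h]
    simp only [coe_inv_apply]

lemma IsSmoothElement.total {X : DSU2} (hX : IsSmoothElement X) : IsSmooth (DSU2.total X) := by
  have h : DSU2.total X = ∑ x ∈ (show SU2 →₀ C(SU2, ℂ) from X).support, X x := rfl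
  rw [h]
  exact Finset.sum_induction _ IsSmooth (fun _ _ => IsSmooth.add) isSmooth_zero fun x _ => hX x

/-! ### Smooth parametric integrals over SU(2) -/

/-- The entries of a matrix of `SU(2)`. -/
def ent (g : SU2) : Fin 2 → Fin 2 → ℂ := fun i j => g.1 i j

lemma continuous_ent : Continuous ent :=
  continuous_pi fun i => continuous_pi fun j => continuous_subtype_val.matrix_elem i j

/-- The derivative is again an integral of the same kind, so the lemma can be iterated. The
dominating constant comes from compactness of `[θ - 1, θ + 1]` times the set of matrices of `SU(2)`.
-/
lemma hasDerivAt_integral_ent {Φ : ℝ × (Fin 2 → Fin 2 → ℂ) → ℂ}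
    (hΦ : ContDiff ℝ ((⊤ : ℕ∞) : WithTop ℕ∞) Φ) :
    ∃ Ψ : ℝ × (Fin 2 → Fin 2 → ℂ) → ℂ, ContDiff ℝ ((⊤ : ℕ∞) : WithTop ℕ∞) Ψ ∧
      ∀ θ, HasDerivAt (fun θ => ∫ g, Φ (θ, ent g) ∂haar) (∫ g, Ψ (θ, ent g) ∂haar) θ := by
  have hΨ : ContDiff ℝ ((⊤ : ℕ∞) : WithTop ℕ∞)
      fun p : ℝ × (Fin 2 → Fin 2 → ℂ) => fderiv ℝ Φ p (1, 0) :=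
    (hΦ.fderiv_right (m := ((⊤ : ℕ∞) : WithTop ℕ∞)) le_rfl).clm_apply contDiff_const
  refine ⟨fun p => fderiv ℝ Φ p (1, 0), hΨ, fun θ => ?_⟩
  have hc : ∀ {Φ : ℝ × (Fin 2 → Fin 2 → ℂ) → ℂ}, Continuous Φ → ∀ θ : ℝ,
      Continuous fun g : SU2 => Φ (θ, ent g) := fun h θ =>
    h.comp (continuous_const.prodMk continuous_ent)
  obtain ⟨C, hC⟩ := ((isCompact_Icc (a := θ - 1) (b := θ + 1)).prod
    (isCompact_range continuous_ent)).bddAbove_image hΨ.continuous.norm.continuousOn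
  refine (hasDerivAt_integral_of_dominated_loc_of_deriv_le (bound := fun _ => C)
    (F := fun θ (g : SU2) => Φ (θ, ent g)) (F' := fun θ (g : SU2) => fderiv ℝ Φ (θ, ent g) (1, 0))
    (Icc_mem_nhds (sub_one_lt θ) (lt_add_one θ))
    (Filter.Eventually.of_forall fun x => (hc hΦ.continuous x).aestronglyMeasurable)
    (integrable_of_continuous (hc hΦ.continuous θ)) (hc hΨ.continuous θ).aestronglyMeasurable
    (ae_of_all _ fun g x hx => hC ⟨(x, ent g), ⟨hx, g, rfl⟩, rfl⟩) (integrable_const _)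
    (ae_of_all _ fun g x _ => ?_)).2
  have h1 : HasFDerivAt Φ (fderiv ℝ Φ (x, ent g)) (x, ent g) :=
    (hΦ.differentiable (by simp) _).hasFDerivAt
  exact h1.comp_hasDerivAt x ((hasDerivAt_id x).prodMk (hasDerivAt_const x (ent g)))

lemma ent_conj_hTheta (g : SU2) (θ : ℝ) : ent (g * hTheta θ * g⁻¹) = fun i j =>
    ent g i 0 * Complex.exp (θ * Complex.I) * starRingEnd ℂ (ent g j 0) +
      ent g i 1 * Complex.exp (-(θ * Complex.I)) * starRingEnd ℂ (ent g j 1) := by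
  ext i j
  change (g * hTheta θ * g⁻¹ : SU2).1 i j = _
  rw [Submonoid.coe_mul, Submonoid.coe_mul]
  simp only [Matrix.mul_apply, Fin.sum_univ_two]
  rw [coe_inv_apply, coe_inv_apply]
  simp [hTheta, ent]

/-- The entries of `g⁻¹` are conjugates of entries of `g`, so the orbit function extends smoothly,
in the real sense, to all matrices. This puts it in the form needed by `hasDerivAt_integral_ent`. -/
lemma IsSmooth.exists_orbit {f : C(SU2, ℂ)} (hf : IsSmooth f) :
    ∃ Φ : ℝ × (Fin 2 → Fin 2 → ℂ) → ℂ, ContDiff ℝ ((⊤ : ℕ∞) : WithTop ℕ∞) Φ ∧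
      ∀ θ (g : SU2), f (g * hTheta θ * g⁻¹) = Φ (θ, ent g) := by
  obtain ⟨F, hF, h⟩ := hf
  refine ⟨fun p => F fun i j =>
    p.2 i 0 * Complex.exp (p.1 * Complex.I) * starRingEnd ℂ (p.2 j 0) +
      p.2 i 1 * Complex.exp (-(p.1 * Complex.I)) * starRingEnd ℂ (p.2 j 1), hF.comp ?_,
    fun θ g => ?_⟩
  · have hofReal : ContDiff ℝ ((⊤ : ℕ∞) : WithTop ℕ∞)
        fun p : ℝ × (Fin 2 → Fin 2 → ℂ) => (p.1 : ℂ) * Complex.I :=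
      (Complex.ofRealCLM.contDiff.comp contDiff_fst).mul contDiff_const
    refine contDiff_pi.mpr fun i => contDiff_pi.mpr fun j => ?_
    exact ((ContDiff.mul (by fun_prop) hofReal.cexp).mul (contDiff_conj_entry (by fun_prop))).add
      ((ContDiff.mul (by fun_prop) hofReal.neg.cexp).mul (contDiff_conj_entry (by fun_prop)))
  · rw [h]
    exact congrArg F (ent_conj_hTheta g θ)

/-! ### Fourier coefficients of periodic functions -/

/-- The Fourier coefficient of a `2π`-periodic function, up to normalisation. -/
noncomputable def circleCoeff (F : ℝ → ℂ) (n : ℤ) : ℂ :=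
  ∫ x in (0 : ℝ)..2 * Real.pi, Complex.exp (-(n * x * Complex.I)) * F x

/-- Integration by parts; the boundary terms cancel by periodicity. -/
lemma circleCoeff_deriv {F F' : ℝ → ℂ} (hF : ∀ x, HasDerivAt F (F' x) x) (hF' : Continuous F')
    (hper : Function.Periodic F (2 * Real.pi)) (n : ℤ) :
    circleCoeff F' n = n * Complex.I * circleCoeff F n := by
  have hcF : Continuous F := continuous_iff_continuousAt.mpr fun x => (hF x).continuousAt
  have hE : ∀ x : ℝ, HasDerivAt (fun x : ℝ => Complex.exp (-(n * x * Complex.I)))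
      (Complex.exp (-(n * x * Complex.I)) * -(n * Complex.I)) x := fun x => by
    have h1 : HasDerivAt (fun x : ℝ => -((n : ℂ) * x * Complex.I)) (-(n * Complex.I)) x := by
      have := (((hasDerivAt_id x).ofReal_comp.const_mul (n : ℂ)).mul_const Complex.I).fun_neg
      simpa using this
    exact h1.cexp
  have hcE : Continuous fun x : ℝ => Complex.exp (-(n * x * Complex.I)) := by fun_prop
  have h2 : ∫ x in (0 : ℝ)..2 * Real.pi,
      (Complex.exp (-(n * x * Complex.I)) * -(n * Complex.I) * F x +
        Complex.exp (-(n * x * Complex.I)) * F' x) =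
      Complex.exp (-(n * ((2 * Real.pi : ℝ) : ℂ) * Complex.I)) * F (2 * Real.pi) -
        Complex.exp (-(n * ((0 : ℝ) : ℂ) * Complex.I)) * F 0 :=
    intervalIntegral.integral_eq_sub_of_hasDerivAt (fun x _ => (hE x).mul (hF x))
      (Continuous.intervalIntegrable (by fun_prop) _ _)
  have h3 : F (2 * Real.pi) = F 0 := by simpa using hper 0
  have h4 : Complex.exp (-(n * ((2 * Real.pi : ℝ) : ℂ) * Complex.I)) = 1 := by
    rw [Complex.exp_eq_one_iff]
    exact ⟨-n, by push_cast; ring⟩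
  rw [intervalIntegral.integral_add (Continuous.intervalIntegrable (by fun_prop) _ _)
    (Continuous.intervalIntegrable (by fun_prop) _ _)] at h2
  have h5 : ∫ x in (0 : ℝ)..2 * Real.pi,
      Complex.exp (-(n * x * Complex.I)) * -(n * Complex.I) * F x =
      -(n * Complex.I) * circleCoeff F n := by
    rw [circleCoeff, ← intervalIntegral.integral_const_mul]
    congr 1; ext x; ring
  have h6 : Complex.exp (-(n * ((0 : ℝ) : ℂ) * Complex.I)) = 1 := by simp
  rw [h5, h3, h4, h6] at h2
  rw [circleCoeff]
  linear_combination h2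

lemma Periodic.of_hasDerivAt {F F' : ℝ → ℂ} {c : ℝ} (hF : ∀ x, HasDerivAt F (F' x) x)
    (hper : Function.Periodic F c) : Function.Periodic F' c := fun x => by
  have h1 := (hF (x + c)).comp_add_const x c
  have h2 : (fun y => F (y + c)) = F := funext hper
  rw [h2] at h1
  exact h1.unique (hF x)

lemma exists_norm_circleCoeff_le (F : ℝ → ℂ) : ∃ C, ∀ n, ‖circleCoeff F n‖ ≤ C := by
  refine ⟨∫ x in (0 : ℝ)..2 * Real.pi, ‖F x‖, fun n => ?_⟩
  refine (intervalIntegral.norm_integral_le_integral_norm Real.two_pi_pos.le).trans (le_of_eq ?_)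
  congr 1
  ext x
  have h : ‖Complex.exp (-(n * x * Complex.I))‖ = 1 := by
    have := Complex.norm_exp_ofReal_mul_I (-(n * x))
    push_cast at this
    rwa [neg_mul] at this
  rw [norm_mul, h, one_mul]

/-- The coefficients of a smooth periodic function decay rapidly. -/
lemma exists_norm_circleCoeff_mul_le {F : ℕ → ℝ → ℂ}
    (hF : ∀ i x, HasDerivAt (F i) (F (i + 1) x) x)
    (hper : Function.Periodic (F 0) (2 * Real.pi)) (k : ℕ) :
    ∃ C, ∀ n : ℤ, ‖circleCoeff (F 0) n‖ * |(n : ℝ)| ^ k ≤ C := by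
  have hc : ∀ i, Continuous (F i) := fun i =>
    continuous_iff_continuousAt.mpr fun x => (hF i x).continuousAt
  have hp : ∀ i, Function.Periodic (F i) (2 * Real.pi) := fun i => by
    induction i with
    | zero => exact hper
    | succ i ih => exact Periodic.of_hasDerivAt (hF i) ih
  have hk : ∀ (n : ℤ) (k : ℕ), ‖circleCoeff (F k) n‖ = ‖circleCoeff (F 0) n‖ * |(n : ℝ)| ^ k := by
    intro n k
    induction k with
    | zero => simp
    | succ k ih =>
      rw [circleCoeff_deriv (hF k) (hc (k + 1)) (hp k), norm_mul, norm_mul, Complex.norm_I,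
        Complex.norm_intCast, ih, pow_succ]
      ring
  obtain ⟨C, hC⟩ := exists_norm_circleCoeff_le (F k)
  exact ⟨C, fun n => by rw [← hk]; exact hC n⟩

lemma hasSum_circleCoeff {F : ℝ → ℂ} (hF : Continuous F)
    (hper : Function.Periodic F (2 * Real.pi)) (hs : Summable fun n => circleCoeff F n) (θ : ℝ) :
    HasSum (fun n : ℤ => (2 * Real.pi : ℂ)⁻¹ * circleCoeff F n * Complex.exp (n * θ * Complex.I))
      (F θ) := by
  have hT : Fact (0 < 2 * Real.pi) := ⟨Real.two_pi_pos⟩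
  have hpi : (Real.pi : ℂ) ≠ 0 := by exact_mod_cast Real.pi_ne_zero
  let f : C(AddCircle (2 * Real.pi), ℂ) := ⟨hper.lift, continuous_quot_lift _ hF⟩
  have hexp : ∀ (n : ℤ) (x : ℝ), fourier n (x : AddCircle (2 * Real.pi)) =
      Complex.exp (n * x * Complex.I) := fun n x => by
    rw [fourier_coe_apply]
    congr 1
    push_cast
    field_simp
  have hcoeff : ∀ n, fourierCoeff f n = (2 * Real.pi : ℂ)⁻¹ * circleCoeff F n := fun n => by
    rw [fourierCoeff_eq_intervalIntegral _ _ 0, zero_add, circleCoeff]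
    have h1 : ∀ x : ℝ, fourier (-n) (x : AddCircle (2 * Real.pi)) • f x =
        Complex.exp (-(n * x * Complex.I)) * F x := fun x => by
      rw [hexp, smul_eq_mul]
      congr 2
      push_cast; ring
    rw [intervalIntegral.integral_congr fun x _ => h1 x, Complex.real_smul]
    push_cast
    rw [one_div]
  have h2 := has_pointwise_sum_fourier_series_of_summable (f := f)
    ((hs.mul_left _).congr fun n => (hcoeff n).symm) (θ : AddCircle (2 * Real.pi))
  simp only [hcoeff, hexp, smul_eq_mul] at h2
  exact h2

/-! ### Character expansion of smooth functions -/

/-- An even trigonometric series as a series of characters. -/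
lemma hasSum_chi_of_hasSum {F : ℝ → ℂ} (heven : ∀ θ, F (-θ) = F θ) {a : ℤ → ℂ}
    (hsum : ∀ θ : ℝ, HasSum (fun n : ℤ => a n * Complex.exp (n * θ * Complex.I)) (F θ))
    {A : ℕ → ℂ} (hA : ∀ n : ℕ, A n = (a n + a (-n)) / 2)
    (hsA : Summable fun n : ℕ => ‖A n‖ * (n + 1)) (θ : ℝ) :
    HasSum (fun j => (A j - A (j + 2)) * chi j (hTheta θ)) (F θ) := by
  set z := Complex.exp (θ * Complex.I)
  set w := Complex.exp (-(θ * Complex.I))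
  have hz : ∀ n : ℕ, Complex.exp (n * θ * Complex.I) = z ^ n := fun n => by
    rw [← Complex.exp_nat_mul]; congr 1; ring
  have hw : ∀ n : ℕ, Complex.exp (-(n * θ * Complex.I)) = w ^ n := fun n => by
    rw [← Complex.exp_nat_mul]; congr 1; ring
  have h1 := (((hsum θ).add (hsum (-θ))).div_const 2).nat_add_neg
  rw [heven, add_self_div_two] at h1
  -- Folding the sum over `ℤ` onto `ℕ` counts the term `n = 0` twice, hence the extra `A 0`.
  have h2 : HasSum (fun n : ℕ => A n * (z ^ n + w ^ n)) (F θ + A 0) := by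
    convert h1 using 1
    · rfl
    · ext n
      push_cast
      rw [hA, show -(n : ℂ) * θ * Complex.I = -(n * θ * Complex.I) by ring,
        show (n : ℂ) * -θ * Complex.I = -(n * θ * Complex.I) by ring,
        show -(n : ℂ) * -θ * Complex.I = n * θ * Complex.I by ring, hz, hw]
      ring
    · rw [hA]; simp
  have hs0 : Summable fun n => A n * chi n (hTheta θ) := by
    refine Summable.of_norm_bounded hsA fun n => ?_
    rw [norm_mul]
    exact mul_le_mul_of_nonneg_left (norm_chi_le n _) (norm_nonneg _)
  have h3 := (hasSum_nat_add_iff' 2).mpr h2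
  have h4 := (hasSum_nat_add_iff' 2).mpr hs0.hasSum
  -- Summation by parts: `z^{n+2} + w^{n+2} = χ_{n+2} - χ_n`, so the difference of the two shifted
  -- series is the sum of `A_{n+2} χ_n`. Subtracting it from the sum of `A_n χ_n` leaves the
  -- coefficients `A_n - A_{n+2}`.
  have h5 := hs0.hasSum.sub (h4.sub h3)
  convert h5 using 1
  · rfl
  · ext j
    linear_combination A (j + 2) * chi_add_two_hTheta j θ
  · simp only [Finset.sum_range_succ, Finset.sum_range_zero, chi_zero, chi_one_hTheta]
    ring

/-- Fubini and conjugation invariance of both the character and Haar measure. Replacing `f` by its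
average thus leaves its character coefficients unchanged. -/
lemma integral_chi_mul_classAverage (j : ℕ) (f : C(SU2, ℂ)) :
    ∫ g, chi j g * classAverage f g ∂haar = ∫ g, chi j g * f g ∂haar := by
  have hc : Continuous fun p : SU2 × SU2 => chi j p.1 * f (p.2 * p.1 * p.2⁻¹) :=
    ((continuous_chi j).comp continuous_fst).mul
      (f.continuous.comp ((continuous_snd.mul continuous_fst).mul continuous_snd.inv))
  calc ∫ g, chi j g * classAverage f g ∂haar
      = ∫ g, ∫ u, chi j g * f (u * g * u⁻¹) ∂haar ∂haar := by
        simp only [classAverage_apply, integral_const_mul]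
    _ = ∫ u, ∫ g, chi j g * f (u * g * u⁻¹) ∂haar ∂haar :=
        integral_integral_swap (hc.integrable_of_hasCompactSupport (HasCompactSupport.of_compactSpace _))
    _ = ∫ _u, ∫ g, chi j g * f g ∂haar ∂haar := by
        refine integral_congr_ae (ae_of_all _ fun u => ?_)
        change ∫ g, chi j g * f (u * g * u⁻¹) ∂haar = ∫ g, chi j g * f g ∂haar
        rw [← integral_mul_left_eq_self (fun g => chi j g * f g) u,
          ← integral_mul_right_eq_self (fun g => chi j (u * g) * f (u * g)) u⁻¹]
        simp only [← mul_assoc, chi_conj]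
    _ = ∫ g, chi j g * f g ∂haar := by simp

lemma hTheta_neg_conj (θ : ℝ) : ∃ u : SU2, hTheta (-θ) = u * hTheta θ * u⁻¹ :=
  exists_conj_hTheta (by rw [halfTrace_hTheta, Real.cos_neg])

lemma hTheta_add_two_pi (θ : ℝ) : hTheta (θ + 2 * Real.pi) = hTheta θ := by
  have : hTheta (2 * Real.pi) = 1 := by
    refine Subtype.ext ?_
    have h1 : Complex.exp (((2 * Real.pi : ℝ) : ℂ) * Complex.I) = 1 := by
      push_cast; exact Complex.exp_two_pi_mul_I
    ext i j
    fin_cases i <;> fin_cases j <;> simp [hTheta, Complex.exp_neg]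
  rw [hTheta_add, this, mul_one]

/-- The character expansion of the orbital integrals of a smooth function. -/
theorem hasSum_chi_orbit {f : C(SU2, ℂ)} (hf : IsSmooth f) (θ : ℝ) :
    HasSum (fun j : ℕ => chi j (hTheta θ) * ∫ g, chi j g * f g ∂haar)
      (∫ g, f (g * hTheta θ * g⁻¹) ∂haar) := by
  obtain ⟨Φ₀, hΦ₀, hfΦ⟩ := hf.exists_orbit
  -- A choice of derivative is iterated to give the whole sequence of derivatives of the orbital
  -- integral.
  choose D hD hDer using @hasDerivAt_integral_ent
  let Φ : ℕ → {Φ : ℝ × (Fin 2 → Fin 2 → ℂ) → ℂ // ContDiff ℝ ((⊤ : ℕ∞) : WithTop ℕ∞) Φ} :=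
    fun i => Nat.rec ⟨Φ₀, hΦ₀⟩ (fun _ Ψ => ⟨D Ψ.2, hD Ψ.2⟩) i
  let F : ℕ → ℝ → ℂ := fun i θ => ∫ g, (Φ i).1 (θ, ent g) ∂haar
  have hF : ∀ i x, HasDerivAt (F i) (F (i + 1) x) x := fun i x => hDer (Φ i).2 x
  have hF0 : ∀ θ, F 0 θ = classAverage f (hTheta θ) := fun θ => by
    rw [classAverage_apply]
    simp only [hfΦ]
    rfl
  have hper : Function.Periodic (F 0) (2 * Real.pi) := fun θ => by
    rw [hF0, hF0, hTheta_add_two_pi]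
  have heven : ∀ θ, F 0 (-θ) = F 0 θ := fun θ => by
    obtain ⟨u, hu⟩ := hTheta_neg_conj θ
    rw [hF0, hF0, hu, classAverage_conj]
  have hcF : Continuous (F 0) := continuous_iff_continuousAt.mpr fun x => (hF 0 x).continuousAt
  -- Cubic decay suffices: the bound `j + 1` on `χ_j` costs one power, leaving a summable inverse
  -- square.
  obtain ⟨C, hC⟩ := exists_norm_circleCoeff_mul_le hF hper 3
  have hC2 : ∀ n : ℤ, n ≠ 0 → ‖circleCoeff (F 0) n‖ ≤ C * (1 / |(n : ℝ)| ^ 3) := fun n hn => by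
    have : 0 < |(n : ℝ)| := abs_pos.mpr (by exact_mod_cast hn)
    rw [mul_one_div, le_div_iff₀ (by positivity)]
    exact hC n
  have hsumm : Summable fun n => circleCoeff (F 0) n := by
    have h1 : Summable fun n : ℤ => C * (1 / |(n : ℝ)| ^ 3) := by
      have := (Real.summable_one_div_int_pow (p := 3)).mpr (by norm_num)
      refine (this.abs.congr fun n => ?_).mul_left C
      rw [abs_div, abs_one, abs_pow]
    refine Summable.of_norm_bounded_eventually h1 ?_
    filter_upwards [(Set.finite_singleton (0 : ℤ)).compl_mem_cofinite] with n hn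
    exact hC2 n hn
  have hsum := hasSum_circleCoeff hcF hper hsumm
  set a : ℤ → ℂ := fun n => (2 * Real.pi : ℂ)⁻¹ * circleCoeff (F 0) n with ha
  let A : ℕ → ℂ := fun n => (a n + a (-n)) / 2
  have hna : ∀ n : ℤ, n ≠ 0 → ‖a n‖ ≤ C * (1 / |(n : ℝ)| ^ 3) := fun n hn => by
    refine le_trans ?_ (hC2 n hn)
    rw [ha, norm_mul]
    refine mul_le_of_le_one_left (norm_nonneg _) ?_
    rw [norm_inv, norm_mul, Complex.norm_real, Real.norm_eq_abs, abs_of_pos Real.pi_pos]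
    refine inv_le_one_of_one_le₀ ?_
    simp only [Complex.norm_ofNat]
    linarith [Real.pi_gt_three]
  have hsA : Summable fun n : ℕ => ‖A n‖ * (n + 1) := by
    have h1 : Summable fun n : ℕ => 2 * C * (1 / (n : ℝ) ^ 2) :=
      (Real.summable_one_div_nat_pow.mpr (by norm_num)).mul_left _
    refine Summable.of_norm_bounded_eventually_nat h1 ?_
    filter_upwards [Filter.eventually_ge_atTop 1] with n hn
    have hn1 : (1 : ℝ) ≤ n := by exact_mod_cast hn
    have k1 := hna n (by omega)
    have k2 := hna (-n) (by omega)
    simp only [Int.cast_neg, abs_neg, Int.cast_natCast, Nat.abs_cast] at k1 k2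
    have k3 : ‖A n‖ ≤ C * (1 / (n : ℝ) ^ 3) := by
      rw [norm_div, Complex.norm_ofNat, div_le_iff₀ two_pos]
      exact (norm_add_le _ _).trans (by linarith)
    have hC0 : 0 ≤ C * (1 / (n : ℝ) ^ 3) := (norm_nonneg _).trans k3
    rw [Real.norm_eq_abs, abs_of_nonneg (by positivity)]
    calc ‖A n‖ * (n + 1) ≤ C * (1 / (n : ℝ) ^ 3) * (2 * n) :=
          mul_le_mul k3 (by linarith) (by positivity) hC0
      _ = 2 * C * (1 / (n : ℝ) ^ 2) := by field_simp
  set B : ℕ → ℂ := fun j => A j - A (j + 2) with hB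
  have hchi := hasSum_chi_of_hasSum heven hsum (A := A) (fun n => rfl) hsA
  have hclass : ∀ g, HasSum (fun j => B j * chi j g) (classAverage f g) := fun g => by
    obtain ⟨ξ, -, u, rfl⟩ := exists_angle g
    rw [classAverage_conj, ← hF0]
    simp only [chi_conj]
    exact hchi ξ
  have hsB : Summable fun j : ℕ => ‖B j‖ * (j + 1) := by
    refine Summable.of_nonneg_of_le (fun j => by positivity) (fun j => ?_)
      (hsA.add ((summable_nat_add_iff 2).mpr hsA))
    have : ‖B j‖ ≤ ‖A j‖ + ‖A (j + 2)‖ := norm_sub_le _ _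
    push_cast
    nlinarith [norm_nonneg (A (j + 2)), norm_nonneg (A j)]
  have hcoef : ∀ k, ∫ g, chi k g * f g ∂haar = B k := fun k => by
    rw [← integral_chi_mul_classAverage]
    have hint : ∀ j, Integrable (fun g => chi k g * (B j * chi j g)) haar := fun j =>
      integrable_chi_mul k (continuous_const.mul (continuous_chi j))
    -- Integrating the expansion termwise against `χ_k`; by orthonormality only the coefficient `B
    -- k` survives.
    have h1 := hasSum_integral_of_summable_integral_norm hint (by
      refine Summable.of_nonneg_of_le (fun j => integral_nonneg fun g => norm_nonneg _)
        (fun j => ?_) (hsB.mul_left ((k : ℝ) + 1))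
      refine (integral_mono (hint j).norm (integrable_const _) (fun g => ?_)).trans
        (le_of_eq (by simp : ∫ _g : SU2, ((k : ℝ) + 1) * (‖B j‖ * (j + 1)) ∂haar = _))
      simp only [norm_mul]
      gcongr
      · exact norm_chi_le k g
      · exact norm_chi_le j g)
    have h2 : ∀ g, ∑' j, chi k g * (B j * chi j g) = chi k g * classAverage f g := fun g =>
      ((hclass g).mul_left _).tsum_eq
    simp only [h2] at h1
    refine h1.unique ?_
    have h3 : ∀ j, ∫ g, chi k g * (B j * chi j g) ∂haar = if j = k then B k else 0 := fun j => by
      have : ∀ g, chi k g * (B j * chi j g) = B j * (chi j g * chi k g) := fun g => by ring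
      simp only [this]
      rw [integral_const_mul, integral_chi_mul_chi]
      split_ifs with h
      · rw [h, mul_one]
      · rw [mul_zero]
    simp only [h3]
    exact hasSum_ite_eq k (B k)
  simp only [hcoef, ← classAverage_apply]
  have hcomm : (fun j => chi j (hTheta θ) * B j) = fun j => B j * chi j (hTheta θ) :=
    funext fun j => mul_comm _ _
  rw [hcomm]
  exact hclass (hTheta θ)

end SU2Double

theorem mainTheorem9 :
    -- the representations labelled `(θ, 0)` are simple
    (∀ θ : ℝ, IsSimple (rep θ 0)) ∧
    -- if `h_θ` is not central (centralizer `U(1)`), then `(θ, s)` is simple exactly when `s = 0`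
    (∀ (θ : ℝ) (s : ℤ), hTheta θ ∉ Subgroup.center SU2 → (IsSimple (rep θ s) ↔ s = 0)) ∧
    -- if `h_θ` is central (centralizer `SU(2)`), then `(θ, π)` is simple exactly when `π` is trivial
    (∀ (θ : ℝ) (hc : hTheta θ ∈ Subgroup.center SU2) (W : Type u) [NormedAddCommGroup W]
      [InnerProductSpace ℂ W] [CompleteSpace W] (π : SU2 →* unitary (W →L[ℂ] W)),
      IsIrreducibleGroupRep π →
        (IsSimple (centralRep (hTheta θ) hc π) ↔ ∀ x : SU2, π x = 1)) ∧
    -- every simple representation is of the form `(θ, 0)`, for a unique class `θ ∈ [0, π]`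
    (∀ (H : Type u) [NormedAddCommGroup H] [InnerProductSpace ℂ H] [CompleteSpace H]
      (ρ : DSU2 →⋆ₐ[ℂ] (H →L[ℂ] H)), IsSimple ρ →
        ∃! θ : ℝ, θ ∈ Set.Icc 0 Real.pi ∧ UnitarilyEquivalent ρ (rep θ 0)) ∧
    -- the normalised invariant vector is `ω = 1`, up to a phase, and `φ = ⟨ω|`
    (∀ (θ : ℝ) (v : vSpace θ 0),
      (v ∈ invVectors (rep θ 0) ∧ ‖v‖ = 1) ↔ ∃ c : ℂ, ‖c‖ = 1 ∧ v = c • omegaOne θ) ∧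
    (∀ (θ : ℝ) (φ : vSpace θ 0 →L[ℂ] ℂ),
      IsNormalizedPair (rep θ 0) φ (omegaOne θ) ↔ φ = innerSL ℂ (omegaOne θ)) ∧
    -- symmetric kernel and propagator of any simple representation labelled by `θ`
    (∀ (θ : ℝ) (H : Type u) [NormedAddCommGroup H] [InnerProductSpace ℂ H] [CompleteSpace H]
      (ρ : DSU2 →⋆ₐ[ℂ] (H →L[ℂ] H)) (φ : H →L[ℂ] ℂ) (ω : H),
      UnitarilyEquivalent ρ (rep θ 0) → IsNormalizedPair ρ φ ω →
      -- the kernel is the element `f ↦ ∫ f (g h_θ g⁻¹) dg` of `F(SU(2))*`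
      (∀ (x : SU2) (f : C(SU2, ℂ)), symKernel ρ φ ω (DSU2.tens x f) =
        ∫ g, f (g * hTheta θ * g⁻¹) ∂haar) ∧
      -- `K = 1 ⊗ ∫ δ_θ(g) g dg`, and `K(x, y) = ∫ δ_θ(g) (1 ⊗ g) ⊗ (1 ⊗ g⁻¹) dg`
      (∃ δ : Measure SU2, IsClassDelta (hTheta θ) δ ∧
        (∀ m : Measure SU2, IsClassDelta (hTheta θ) m → m = δ) ∧
        (∀ X : DSU2, symKernel ρ φ ω X = ∫ g, DSU2.dualTens 1 g X ∂δ) ∧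
        (∀ X Y : DSU2, propagator (symKernel ρ φ ω) X Y =
          ∫ g, DSU2.dualTens 1 g X * DSU2.dualTens 1 g⁻¹ Y ∂δ)) ∧
      -- `K = 1 ⊗ ∑_j χ_j(h_θ) ∫ χ_j(g) g dg`
      (∀ X : DSU2, IsSmoothElement X →
        HasSum (fun j : ℕ => chi j (hTheta θ) * ∫ g, chi j g * DSU2.dualTens 1 g X ∂haar)
          (symKernel ρ φ ω X)) ∧
      -- `K(x, y) = ∑_j χ_j(h_θ) ∫ χ_j(g) (1 ⊗ g) ⊗ (1 ⊗ g⁻¹) dg`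
      (∀ X Y : DSU2, IsSmoothElement X → IsSmoothElement Y →
        HasSum (fun j : ℕ => chi j (hTheta θ) *
            ∫ g, chi j g * (DSU2.dualTens 1 g X * DSU2.dualTens 1 g⁻¹ Y) ∂haar)
          (propagator (symKernel ρ φ ω) X Y))) := by
  refine ⟨isSimple_rep, fun θ s _ => isSimple_rep_iff θ s,
    fun θ hc W _ _ _ π hπ => isSimple_centralRep_iff _ hc π hπ,
    fun H _ _ _ ρ hρ => hρ.existsUnique_angle, unit_invVector_rep_iff, isNormalizedPair_rep_iff,
    fun θ H _ _ _ ρ φ ω hU hp => ⟨symKernel_tens hU hp,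
      ⟨classDelta (hTheta θ), isClassDelta_classDelta _, fun m hm => hm.eq_classDelta,
        fun X => ?_, fun X Y => ?_⟩, fun X hX => ?_, fun X Y hX hY => ?_⟩⟩
  · simp only [DSU2.dualTens_one]
    rw [symKernel_eq hU hp, integral_classDelta]
  · simp only [DSU2.dualTens_one]
    rw [propagator_eq hU hp, ← integral_classDelta]
    rfl
  · simp only [DSU2.dualTens_one]
    rw [symKernel_eq hU hp]
    exact hasSum_chi_orbit hX.total θ
  -- The propagator is the orbital integral of the product of one total with the inversion of the
  -- other. This product is again smooth, so the same expansion applies. In `ℂ`, `HasSum` is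
  -- unconditional and hence absolute convergence.
  · simp only [DSU2.dualTens_one]
    rw [propagator_eq hU hp]
    exact hasSum_chi_orbit (hX.total.mul hY.total.invFun) θ
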